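/- Let $N\in\mathbb N$ and, for $0<\lambda<N$ and $1\le p<\infty$, put $$\|f\|_{M^\lambda_p}=\Big(\sup_{x\in\mathbb R^N}\sup_{\rho>0}\rho^{-\lambda}\int_{B(x,\rho)}|f(y)|^p\,dy\Big)^{1/p}\in[0,\infty],$$ where $B(x,\rho)$ is the Euclidean ball; $M^\lambda_p=M^\lambda_p(\mathbb R^N)$ is the space of measurable $f$ with $\|f\|_{M^\lambda_p}<\infty$. Powers of norms are taken with $t^0=1$ for all $t\in[0,\infty]$. Let $a\in[0,1]$, $q>1$ and $1\le r<\infty$. (Integer case.) Let $1<p<N$ and $0<\lambda<N-p$, and assume $$\frac1q=a\Big(\frac1p-\frac1{N-\lambda}\Big)+\frac{1-a}{r}.$$ Then there is a constant $C>0$ such that $$\|u\|_{M^\lambda_q}\le C\,\|\nabla u\|_{M^\lambda_p}^{a}\,\|u\|_{M^\lambda_r}^{1-a}$$ for every real-valued $u\in M^\lambda_r(\mathbb R^N)$ with a weak gradient $\nabla u\in L^1_{\mathrm{loc}}(\mathbb R^N;\mathbb R^N)$. (Fractional case.) Let $\gamma\in(0,1)$, $1<p<\frac N\gamma$ and $0<\lambda<N-\gamma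 p$, and assume $$\frac1q=a\Big(\frac1p-\frac\gamma{N-\lambda}\Big)+\frac{1-a}{r}.$$ Then there is a constant $C>0$ such that $$\|u\|_{M^\lambda_q}\le C\,\|(-\Delta)^{\gamma/2}u\|_{M^\lambda_p}^{a}\,\|u\|_{M^\lambda_r}^{1-a}$$ for every real-valued Schwartz function $u$ on $\mathbb R^N$, where for $0<s<1$ $$(-\Delta)^su(x)=\frac{A(N,s)}2\int_{\mathbb R^N}\frac{2u(x)-u(x+y)-u(x-y)}{|y|^{N+2s}}\,dy,\qquad A(N,s)=\frac{s\,2^{2s}\,\Gamma(\frac{N+2s}2)}{\pi^{N/2}\,\Gamma(1-s)}.$$ In both cases $C$ does not depend on $u$. -/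

import Mathlib

open MeasureTheory
open scoped ENNReal ContDiff SchwartzMap

noncomputable section

/-- The global Morrey norm on `ℝ^N`, with values in `[0, ∞]`:
`‖f‖ = (sup_x sup_{ρ > 0} ρ^{-lam} ∫_{B(x,ρ)} |f|^p)^{1/p}`.
For a vector-valued `f` (such as a gradient) `|f|` is the Euclidean length. -/
def morreyNorm {N : ℕ} {F : Type*} [NormedAddCommGroup F] (lam p : ℝ)
    (f : EuclideanSpace ℝ (Fin N) → F) : ℝ≥0∞ :=
  (⨆ (x : EuclideanSpace ℝ (Fin N)) (ρ : ℝ) (_ : 0 < ρ),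
    ENNReal.ofReal (ρ ^ (-lam)) * ∫⁻ y in Metric.ball x ρ, ‖f y‖ₑ ^ p) ^ (1 / p)

/-- Membership in the global Morrey space: `f` is measurable with finite Morrey norm. Finiteness
of the norm contains `f ∈ L^p_loc`. -/
def MemMorrey {N : ℕ} {F : Type*} [NormedAddCommGroup F] (lam p : ℝ)
    (f : EuclideanSpace ℝ (Fin N) → F) : Prop :=
  AEStronglyMeasurable f volume ∧ morreyNorm lam p f < ⊤

/-- `G` is the weak (distributional) gradient of `u` on `ℝ^N`: both are locally integrable, and
`∫ u ∂_v φ = - ∫ φ ⟨G, v⟩` for all test functions `φ ∈ C_c^∞` and all directions `v`. -/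
structure HasWeakGradient {N : ℕ} (u : EuclideanSpace ℝ (Fin N) → ℝ)
    (G : EuclideanSpace ℝ (Fin N) → EuclideanSpace ℝ (Fin N)) : Prop where
  locallyIntegrable : LocallyIntegrable u volume
  locallyIntegrable_grad : LocallyIntegrable G volume
  integral_eq : ∀ φ : EuclideanSpace ℝ (Fin N) → ℝ, ContDiff ℝ ∞ φ → HasCompactSupport φ →
    ∀ v : EuclideanSpace ℝ (Fin N),
      ∫ x, u x * fderiv ℝ φ x v = - ∫ x, φ x * inner ℝ (G x) v

/-- The normalization constant of the fractional Laplacian `(-Δ)^s` on `ℝ^N`, the one for which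
its Fourier symbol is `|ξ|^{2s}`:
`A(N,s) = s 2^{2s} Γ((N+2s)/2) / (π^{N/2} Γ(1-s))`. -/
def fracLaplacianConst (N : ℕ) (s : ℝ) : ℝ :=
  s * 2 ^ (2 * s) * Real.Gamma ((N + 2 * s) / 2) /
    (Real.pi ^ ((N : ℝ) / 2) * Real.Gamma (1 - s))

/-- The fractional Laplacian `(-Δ)^s`, `0 < s < 1`, of a Schwartz function on `ℝ^N`:
`(-Δ)^s u(x) = (A(N,s)/2) ∫ (2u(x) - u(x+y) - u(x-y)) / |y|^{N+2s} dy`. -/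
def fracLaplacian {N : ℕ} (s : ℝ) (u : 𝓢(EuclideanSpace ℝ (Fin N), ℝ))
    (x : EuclideanSpace ℝ (Fin N)) : ℝ :=
  fracLaplacianConst N s / 2 *
    ∫ y : EuclideanSpace ℝ (Fin N),
      (2 * u x - u (x + y) - u (x - y)) / ‖y‖ ^ ((N : ℝ) + 2 * s)

end

/-! Put γ = 1 in the integer case and define s by 1/s = 1/p - γ/(N - lam). The assumption on q then
reads 1/q = a/s + (1 - a)/r, so Hölder on each ball (`eMorrey_interpolation`) reduces everything to
the case a = 1, a Sobolev inequality from M^lam_p to M^lam_s.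

That inequality has two ingredients. The first is Adams' theorem for the Riesz potential
(`exists_eMorrey_rieszJ_le`). Writing the potential as ∫ t^(γ-1) (average over B(x,t)) dt, averages
at small t are bounded by the maximal function and those at large t by t^(-(N-lam)/p) times the
Morrey norm. Balancing the two gives Hedberg's bound (Mg)^(1-θ) ‖g‖^θ with θ = γp/(N-lam) and 1-θ =
p/s, and the maximal operator is bounded on Morrey spaces.

The second is the pointwise domination of u by the Riesz potential of its derivative. For smooth u
it is the fundamental theorem of calculus averaged over directions; the term at infinity disappears
because u has finite M^lam_r norm and lam < N. Weak gradients are reached by mollification, which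
does not increase Morrey norms, and Fatou. In the fractional case the singular integral has Fourier
symbol c|ξ|^γ with c > 0, and this multiplier is inverted by a weighted integral of Gaussians, whose
kernel is a multiple of |x-y|^(γ-N). Only the positivity of the constants matters, so none is
evaluated against the normalization. -/

/-! ### Morrey norms of nonnegative functions and their interpolation -/

/-- The Morrey norm of a `[0, ∞]`-valued function. -/
noncomputable def eMorrey {N : ℕ} (lam p : ℝ) (g : EuclideanSpace ℝ (Fin N) → ℝ≥0∞) : ℝ≥0∞ :=
  (⨆ (x : EuclideanSpace ℝ (Fin N)) (ρ : ℝ) (_ : 0 < ρ),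
    ENNReal.ofReal (ρ ^ (-lam)) * ∫⁻ y in Metric.ball x ρ, g y ^ p) ^ (1 / p)

theorem morreyNorm_eq_eMorrey {N : ℕ} {F : Type*} [NormedAddCommGroup F] (lam p : ℝ)
    (f : EuclideanSpace ℝ (Fin N) → F) : morreyNorm lam p f = eMorrey lam p (fun x => ‖f x‖ₑ) :=
  rfl

theorem ENNReal.ofReal_rpow_mul_cancel {ρ : ℝ} (hρ : 0 < ρ) (a b : ℝ) :
    ENNReal.ofReal (ρ ^ a) * ENNReal.ofReal (ρ ^ b) = ENNReal.ofReal (ρ ^ (a + b)) := by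
  rw [← ENNReal.ofReal_mul (by positivity), Real.rpow_add hρ]

theorem ENNReal.ofReal_rpow_rpow {ρ : ℝ} (hρ : 0 < ρ) (a b : ℝ) :
    ENNReal.ofReal (ρ ^ a) ^ b = ENNReal.ofReal (ρ ^ (a * b)) := by
  rw [ENNReal.ofReal_rpow_of_pos (by positivity), Real.rpow_mul hρ.le]

section Morrey

variable {N : ℕ} {lam p : ℝ}

theorem eMorrey_rpow (hp : 0 < p) (g : EuclideanSpace ℝ (Fin N) → ℝ≥0∞) :
    eMorrey lam p g ^ p = ⨆ (x : EuclideanSpace ℝ (Fin N)) (ρ : ℝ) (_ : 0 < ρ),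
      ENNReal.ofReal (ρ ^ (-lam)) * ∫⁻ y in Metric.ball x ρ, g y ^ p := by
  rw [eMorrey, ← ENNReal.rpow_mul, one_div_mul_cancel hp.ne', ENNReal.rpow_one]

theorem setLIntegral_ball_le_eMorrey (hp : 0 < p) (g : EuclideanSpace ℝ (Fin N) → ℝ≥0∞)
    (x : EuclideanSpace ℝ (Fin N)) {ρ : ℝ} (hρ : 0 < ρ) :
    ∫⁻ y in Metric.ball x ρ, g y ^ p ≤ ENNReal.ofReal (ρ ^ lam) * eMorrey lam p g ^ p := by
  have h : ENNReal.ofReal (ρ ^ (-lam)) * ∫⁻ y in Metric.ball x ρ, g y ^ p ≤ eMorrey lam p g ^ p := by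
    rw [eMorrey_rpow hp]
    exact le_iSup_of_le x (le_iSup_of_le ρ (le_iSup_of_le hρ le_rfl))
  calc ∫⁻ y in Metric.ball x ρ, g y ^ p
      = ENNReal.ofReal (ρ ^ lam) * (ENNReal.ofReal (ρ ^ (-lam)) * ∫⁻ y in Metric.ball x ρ, g y ^ p) := by
        rw [← mul_assoc, ENNReal.ofReal_rpow_mul_cancel hρ]; simp
    _ ≤ _ := by gcongr

theorem eMorrey_le_of_forall (hp : 0 < p) {g : EuclideanSpace ℝ (Fin N) → ℝ≥0∞} {K : ℝ≥0∞}
    (h : ∀ (x : EuclideanSpace ℝ (Fin N)) (ρ : ℝ), 0 < ρ →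
      ∫⁻ y in Metric.ball x ρ, g y ^ p ≤ ENNReal.ofReal (ρ ^ lam) * K ^ p) :
    eMorrey lam p g ≤ K := by
  rw [← ENNReal.rpow_le_rpow_iff hp, eMorrey_rpow hp]
  refine iSup_le fun x => iSup_le fun ρ => iSup_le fun hρ => ?_
  calc _ ≤ ENNReal.ofReal (ρ ^ (-lam)) * (ENNReal.ofReal (ρ ^ lam) * K ^ p) := by
        gcongr; exact h x ρ hρ
    _ = K ^ p := by rw [← mul_assoc, ENNReal.ofReal_rpow_mul_cancel hρ]; simp

theorem eMorrey_mono_ae (hp : 0 < p) {f g : EuclideanSpace ℝ (Fin N) → ℝ≥0∞}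
    (h : ∀ᵐ x, f x ≤ g x) : eMorrey lam p f ≤ eMorrey lam p g := by
  refine eMorrey_le_of_forall hp fun x ρ hρ => le_trans ?_ (setLIntegral_ball_le_eMorrey hp g x hρ)
  refine lintegral_mono_ae ((ae_restrict_of_ae h).mono fun y hy => ?_)
  gcongr

theorem eMorrey_const_mul_le (hp : 0 < p) (g : EuclideanSpace ℝ (Fin N) → ℝ≥0∞) {c : ℝ≥0∞}
    (hc : c ≠ ⊤) : eMorrey lam p (fun x => c * g x) ≤ c * eMorrey lam p g := by
  refine eMorrey_le_of_forall hp fun x ρ hρ => ?_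
  simp_rw [ENNReal.mul_rpow_of_nonneg _ _ hp.le]
  rw [lintegral_const_mul' _ _ (ENNReal.rpow_ne_top_of_nonneg hp.le hc)]
  calc _ ≤ c ^ p * (ENNReal.ofReal (ρ ^ lam) * eMorrey lam p g ^ p) := by
        gcongr; exact setLIntegral_ball_le_eMorrey hp g x hρ
    _ = _ := by ring

/-- Hölder interpolation between Morrey norms. -/
theorem eMorrey_interpolation {q s r a : ℝ} (hq : 0 < q) (hs : 0 < s) (hr : 0 < r)
    (ha : a ∈ Set.Icc (0 : ℝ) 1) (h : 1 / q = a / s + (1 - a) / r)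
    {g : EuclideanSpace ℝ (Fin N) → ℝ≥0∞} (hg : AEMeasurable g) :
    eMorrey lam q g ≤ eMorrey lam s g ^ a * eMorrey lam r g ^ (1 - a) := by
  obtain ⟨ha0, ha1⟩ := ha
  have h1a : 0 ≤ 1 - a := by linarith
  -- These are the two Hölder weights. Both norms carry the same `lam`, so the powers of `ρ`
  -- recombine to exactly `ρ ^ lam`.
  have hsum : q * a / s + q * (1 - a) / r = 1 := by
    have : q * (1 / q) = 1 := by field_simp
    rw [h] at this
    linear_combination this
  refine eMorrey_le_of_forall hq fun x ρ hρ => ?_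
  have hpt : ∀ y, g y ^ q = (g y ^ s) ^ (q * a / s) * (g y ^ r) ^ (q * (1 - a) / r) := by
    intro y
    rw [← ENNReal.rpow_mul, ← ENNReal.rpow_mul, ← ENNReal.rpow_add_of_nonneg _ _ (by positivity)
      (by positivity)]
    congr 1
    rw [mul_div_cancel₀ _ hs.ne', mul_div_cancel₀ _ hr.ne']
    ring
  simp_rw [hpt]
  refine (ENNReal.lintegral_mul_norm_pow_le (hg.restrict.pow_const _) (hg.restrict.pow_const _)
    (by positivity) (by positivity) hsum).trans ?_
  calc _ ≤ (ENNReal.ofReal (ρ ^ lam) * eMorrey lam s g ^ s) ^ (q * a / s) *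
        (ENNReal.ofReal (ρ ^ lam) * eMorrey lam r g ^ r) ^ (q * (1 - a) / r) := by
        gcongr
        · exact setLIntegral_ball_le_eMorrey hs g x hρ
        · exact setLIntegral_ball_le_eMorrey hr g x hρ
    _ = (ENNReal.ofReal (ρ ^ lam) ^ (q * a / s) * ENNReal.ofReal (ρ ^ lam) ^ (q * (1 - a) / r)) *
        ((eMorrey lam s g ^ s) ^ (q * a / s) * (eMorrey lam r g ^ r) ^ (q * (1 - a) / r)) := by
        rw [ENNReal.mul_rpow_of_nonneg _ _ (by positivity),
          ENNReal.mul_rpow_of_nonneg _ _ (by positivity)]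
        ring
    _ = _ := by
        rw [← ENNReal.rpow_add_of_nonneg _ _ (by positivity) (by positivity), hsum,
          ENNReal.rpow_one, ENNReal.mul_rpow_of_nonneg _ _ hq.le]
        simp_rw [← ENNReal.rpow_mul]
        congr 3 <;> field_simp

end Morrey

/-! ### Ball averages and the Hardy–Littlewood maximal function -/

/-- Integral average over a ball, up to the volume of the unit ball. -/
noncomputable def ballAvg {N : ℕ} (g : EuclideanSpace ℝ (Fin N) → ℝ≥0∞)
    (x : EuclideanSpace ℝ (Fin N)) (t : ℝ) : ℝ≥0∞ :=
  ENNReal.ofReal (t ^ (-(N : ℝ))) * ∫⁻ y in Metric.ball x t, g y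

/-- The volume of the unit ball. -/
noncomputable def unitBallVol (N : ℕ) : ℝ≥0∞ :=
  volume (Metric.ball (0 : EuclideanSpace ℝ (Fin N)) 1)

theorem unitBallVol_ne_top (N : ℕ) : unitBallVol N ≠ ⊤ := measure_ball_lt_top.ne

theorem unitBallVol_ne_zero (N : ℕ) : unitBallVol N ≠ 0 :=
  (Metric.measure_ball_pos _ _ one_pos).ne'

theorem volume_ball_eq {N : ℕ} (x : EuclideanSpace ℝ (Fin N)) {t : ℝ} (ht : 0 < t) :
    volume (Metric.ball x t) = ENNReal.ofReal (t ^ (N : ℝ)) * unitBallVol N := by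
  rw [Measure.addHaar_ball_of_pos _ _ ht, finrank_euclideanSpace_fin, Real.rpow_natCast]
  rfl

/-- Hölder against the constant 1 on the ball. The resulting decay in `t` serves twice: for the far
part of the Riesz potential, and to remove the boundary term at infinity in the gradient estimate.
-/
theorem ballAvg_le_eMorrey {N : ℕ} {lam p : ℝ} (hp : 1 ≤ p)
    {g : EuclideanSpace ℝ (Fin N) → ℝ≥0∞} (hg : AEMeasurable g)
    (x : EuclideanSpace ℝ (Fin N)) {t : ℝ} (ht : 0 < t) :
    ballAvg g x t ≤ unitBallVol N ^ (1 - 1 / p) * ENNReal.ofReal (t ^ (-((N - lam) / p))) *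
      eMorrey lam p g := by
  have hp0 : 0 < p := by linarith
  have h1 : 0 ≤ 1 - 1 / p := by
    rw [sub_nonneg, div_le_one hp0]; exact hp
  have h2 : ∫⁻ y in Metric.ball x t, g y ≤
      (ENNReal.ofReal (t ^ lam) * eMorrey lam p g ^ p) ^ (1 / p) *
        (ENNReal.ofReal (t ^ (N : ℝ)) * unitBallVol N) ^ (1 - 1 / p) := by
    have := ENNReal.lintegral_mul_norm_pow_le (μ := volume.restrict (Metric.ball x t))
      (f := fun y => g y ^ p) (g := fun _ => 1)
      (hg.restrict.pow_const _) aemeasurable_const (p := 1 / p) (q := 1 - 1 / p)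
      (by positivity) h1 (by ring)
    simp only [ENNReal.one_rpow, mul_one, lintegral_const, one_mul, Measure.restrict_apply_univ,
      ← ENNReal.rpow_mul, mul_one_div_cancel hp0.ne', ENNReal.rpow_one, volume_ball_eq x ht] at this
    refine this.trans ?_
    gcongr
    exact setLIntegral_ball_le_eMorrey hp0 g x ht
  rw [ballAvg]
  calc _ ≤ ENNReal.ofReal (t ^ (-(N : ℝ))) *
      ((ENNReal.ofReal (t ^ lam) * eMorrey lam p g ^ p) ^ (1 / p) *
        (ENNReal.ofReal (t ^ (N : ℝ)) * unitBallVol N) ^ (1 - 1 / p)) := by gcongr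
    _ = (ENNReal.ofReal (t ^ (-(N : ℝ))) * ENNReal.ofReal (t ^ (lam * (1 / p))) *
        ENNReal.ofReal (t ^ ((N : ℝ) * (1 - 1 / p)))) *
        (unitBallVol N ^ (1 - 1 / p) * eMorrey lam p g) := by
        rw [ENNReal.mul_rpow_of_nonneg _ _ (by positivity), ENNReal.mul_rpow_of_nonneg _ _ h1,
          ENNReal.ofReal_rpow_rpow ht, ENNReal.ofReal_rpow_rpow ht, ← ENNReal.rpow_mul,
          mul_one_div_cancel hp0.ne', ENNReal.rpow_one]
        ring
    _ = _ := by
        rw [ENNReal.ofReal_rpow_mul_cancel ht, ENNReal.ofReal_rpow_mul_cancel ht]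
        have : -(N : ℝ) + lam * (1 / p) + N * (1 - 1 / p) = -((N - lam) / p) := by field_simp; ring
        rw [this]; ring

/-- The (centred) Hardy–Littlewood maximal function. -/
noncomputable def maxFn {N : ℕ} (g : EuclideanSpace ℝ (Fin N) → ℝ≥0∞)
    (x : EuclideanSpace ℝ (Fin N)) : ℝ≥0∞ :=
  ⨆ (t : ℝ) (_ : 0 < t), ballAvg g x t

section Maximal

variable {N : ℕ}

theorem ballAvg_le_maxFn (g : EuclideanSpace ℝ (Fin N) → ℝ≥0∞)
    (x : EuclideanSpace ℝ (Fin N)) {t : ℝ} (ht : 0 < t) : ballAvg g x t ≤ maxFn g x :=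
  le_iSup_of_le t (le_iSup_of_le ht le_rfl)

theorem ball_eq_iUnion_ball_sub (x : EuclideanSpace ℝ (Fin N)) (t : ℝ) :
    Metric.ball x t = ⋃ n : ℕ, Metric.ball x (t - 1 / (n + 1 : ℝ)) := by
  ext y
  simp only [Set.mem_iUnion, Metric.mem_ball]
  constructor
  · intro h
    obtain ⟨n, hn⟩ := exists_nat_one_div_lt (sub_pos.2 h)
    exact ⟨n, by linarith⟩
  · rintro ⟨n, hn⟩
    have : (0 : ℝ) < 1 / (n + 1 : ℝ) := by positivity
    linarith

/-- If an average exceeds `s`, then so does the integral over a slightly smaller concentric ball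
with the normalization `t ^ (-N)` kept. The ball of radius `t` about any nearby centre contains that
smaller ball. Measurability of `g` plays no role. -/
theorem isOpen_lt_maxFn (g : EuclideanSpace ℝ (Fin N) → ℝ≥0∞) (s : ℝ≥0∞) :
    IsOpen {x | s < maxFn g x} := by
  rw [Metric.isOpen_iff]
  intro x hx
  simp only [Set.mem_ofPred_eq, maxFn, lt_iSup_iff] at hx
  obtain ⟨t, ht, hst⟩ := hx
  have hdir : Directed (· ⊆ ·) fun n : ℕ => Metric.ball x (t - 1 / (n + 1 : ℝ)) := by
    refine Monotone.directed_le fun m n hmn => Metric.ball_subset_ball ?_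
    have : (1 : ℝ) / (n + 1) ≤ 1 / (m + 1) := by gcongr
    linarith
  rw [ballAvg, ball_eq_iUnion_ball_sub, setLIntegral_iUnion_of_directed _ hdir,
    ENNReal.mul_iSup, lt_iSup_iff] at hst
  obtain ⟨n, hn⟩ := hst
  refine ⟨1 / (n + 1 : ℝ), by positivity, fun y hy => ?_⟩
  refine (hn.trans_le ?_).trans_le (ballAvg_le_maxFn g y ht)
  rw [ballAvg]
  gcongr
  refine Metric.ball_subset_ball' ?_
  rw [Metric.mem_ball, dist_comm] at hy
  linarith

theorem measurable_maxFn (g : EuclideanSpace ℝ (Fin N) → ℝ≥0∞) : Measurable (maxFn g) :=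
  measurable_of_Ioi fun s => (isOpen_lt_maxFn g s).measurableSet

/-- Vitali covering: each point of the level set carries a ball on which `g` has large integral; a
disjoint subfamily, dilated by 4, still covers the set. -/
theorem maxFn_weak_type (hN : 0 < N) (g : EuclideanSpace ℝ (Fin N) → ℝ≥0∞) {s : ℝ≥0∞}
    (hs : s ≠ 0) (hs' : s ≠ ⊤) :
    s * volume {x | s < maxFn g x} ≤ ENNReal.ofReal (4 ^ (N : ℝ)) * unitBallVol N * ∫⁻ y, g y := by
  by_cases hI : ∫⁻ y, g y = ⊤
  · rw [hI, ENNReal.mul_top]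
    · exact le_top
    · exact mul_ne_zero (by simp) (unitBallVol_ne_zero N)
  have hsel : ∀ x, ∃ t : ℝ, x ∈ {x | s < maxFn g x} → 0 < t ∧ s < ballAvg g x t := by
    intro x
    by_cases hx : x ∈ {x | s < maxFn g x}
    · simp only [Set.mem_ofPred_eq, maxFn, lt_iSup_iff] at hx
      obtain ⟨t, ht, hst⟩ := hx
      exact ⟨t, fun _ => ⟨ht, hst⟩⟩
    · exact ⟨0, fun h => absurd h hx⟩
  choose r hr using hsel
  have hkey : ∀ x ∈ {x | s < maxFn g x},
      s * ENNReal.ofReal (r x ^ (N : ℝ)) ≤ ∫⁻ y in Metric.ball x (r x), g y := by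
    intro x hx
    obtain ⟨h0, h1⟩ := hr x hx
    calc s * ENNReal.ofReal (r x ^ (N : ℝ))
        ≤ ballAvg g x (r x) * ENNReal.ofReal (r x ^ (N : ℝ)) := by gcongr
      _ = (ENNReal.ofReal (r x ^ (-(N : ℝ))) * ENNReal.ofReal (r x ^ (N : ℝ))) *
          ∫⁻ y in Metric.ball x (r x), g y := by rw [ballAvg]; ring
      _ = _ := by rw [ENNReal.ofReal_rpow_mul_cancel h0]; simp
  -- The covering lemma needs bounded radii. They are bounded because the total integral is finite,
  -- which is why the infinite case was settled beforehand.
  have hbdd : ∀ x ∈ {x | s < maxFn g x},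
      r x ≤ (((∫⁻ y, g y) / s).toReal) ^ (1 / (N : ℝ)) := by
    intro x hx
    have h0 := (hr x hx).1
    have h1 : ENNReal.ofReal (r x ^ (N : ℝ)) ≤ (∫⁻ y, g y) / s := by
      rw [ENNReal.le_div_iff_mul_le (Or.inl hs) (Or.inl hs'), mul_comm]
      exact (hkey x hx).trans (setLIntegral_le_lintegral _ _)
    have h2 : r x ^ (N : ℝ) ≤ ((∫⁻ y, g y) / s).toReal :=
      (ENNReal.ofReal_le_iff_le_toReal (ENNReal.div_ne_top hI hs)).1 h1
    have hN' : (N : ℝ) ≠ 0 := by positivity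
    calc r x = (r x ^ (N : ℝ)) ^ (1 / (N : ℝ)) := by
          rw [← Real.rpow_mul h0.le, mul_one_div_cancel hN', Real.rpow_one]
      _ ≤ _ := by gcongr
  obtain ⟨u, hu, hdisj, hcov⟩ := Vitali.exists_disjoint_subfamily_covering_enlargement_ball
    {x | s < maxFn g x} id r _ hbdd 4 (by norm_num)
  have hcount : u.Countable := hdisj.countable_of_isOpen (fun _ _ => Metric.isOpen_ball)
    (fun x hx => ⟨x, Metric.mem_ball_self (hr x (hu hx)).1⟩)
  have hsub : {x | s < maxFn g x} ⊆ ⋃ b ∈ u, Metric.ball b (4 * r b) := by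
    intro x hx
    obtain ⟨b, hb, hxb⟩ := hcov x hx
    exact Set.mem_biUnion hb (hxb (Metric.mem_ball_self (hr x hx).1))
  have : Countable u := hcount
  calc s * volume {x | s < maxFn g x}
      ≤ s * ∑' b : u, volume (Metric.ball (b : EuclideanSpace ℝ (Fin N)) (4 * r b)) := by
        gcongr
        exact (measure_mono hsub).trans (measure_biUnion_le _ hcount _)
    _ = ∑' b : u, s * volume (Metric.ball (b : EuclideanSpace ℝ (Fin N)) (4 * r b)) := by
        rw [ENNReal.tsum_mul_left]
    _ ≤ ∑' b : u, ENNReal.ofReal (4 ^ (N : ℝ)) * unitBallVol N *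
          ∫⁻ y in Metric.ball (b : EuclideanSpace ℝ (Fin N)) (r b), g y := by
        refine ENNReal.tsum_le_tsum fun b => ?_
        have h0 := (hr b (hu b.2)).1
        rw [volume_ball_eq _ (by positivity), Real.mul_rpow (by norm_num) h0.le,
          ENNReal.ofReal_mul (by positivity)]
        calc _ = ENNReal.ofReal (4 ^ (N : ℝ)) * unitBallVol N *
              (s * ENNReal.ofReal (r b ^ (N : ℝ))) := by ring
          _ ≤ _ := by gcongr; exact hkey b (hu b.2)
    _ = ENNReal.ofReal (4 ^ (N : ℝ)) * unitBallVol N *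
          ∫⁻ y in ⋃ b ∈ u, Metric.ball b (r b), g y := by
        rw [ENNReal.tsum_mul_left]
        congr 1
        exact (lintegral_biUnion hcount (fun _ _ => measurableSet_ball) hdisj _).symm
    _ ≤ _ := mul_le_mul_right (setLIntegral_le_lintegral _ _) _

/-- Splitting off the part of `g` above a level. -/
theorem maxFn_le_add_const (g : EuclideanSpace ℝ (Fin N) → ℝ≥0∞) (c : ℝ≥0∞)
    (x : EuclideanSpace ℝ (Fin N)) :
    maxFn g x ≤ maxFn ({y | c < g y}.indicator g) x + c * unitBallVol N := by
  refine iSup_le fun t => iSup_le fun ht => ?_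
  have hpt : ∀ y, g y ≤ c + {y | c < g y}.indicator g y := by
    intro y
    by_cases hy : c < g y
    · rw [Set.indicator_of_mem (by exact hy)]; exact le_add_self
    · exact (not_lt.1 hy).trans le_self_add
  calc ballAvg g x t ≤ ENNReal.ofReal (t ^ (-(N : ℝ))) *
        ∫⁻ y in Metric.ball x t, (c + {y | c < g y}.indicator g y) := by
        rw [ballAvg]; gcongr; exact hpt _
    _ = ENNReal.ofReal (t ^ (-(N : ℝ))) * ENNReal.ofReal (t ^ (N : ℝ)) * (c * unitBallVol N) +
        ballAvg ({y | c < g y}.indicator g) x t := by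
        rw [lintegral_add_left measurable_const, lintegral_const, Measure.restrict_apply_univ,
          volume_ball_eq x ht, ballAvg]
        ring
    _ ≤ _ := by
        rw [ENNReal.ofReal_rpow_mul_cancel ht, add_comm, neg_add_cancel, Real.rpow_zero,
          ENNReal.ofReal_one, one_mul]
        exact add_le_add_left (ballAvg_le_maxFn _ x ht) _

/-- The layer-cake formula for a single value, with `m = ⊤` included so that no finiteness of the
maximal function has to be known. -/
theorem lintegral_Ioi_rpow_indicator {α : ℝ} (hα : 0 < α) (m : ℝ≥0∞) :
    ∫⁻ s in Set.Ioi (0 : ℝ), ENNReal.ofReal (s ^ (α - 1)) *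
      {s : ℝ | ENNReal.ofReal s < m}.indicator 1 s = ENNReal.ofReal (1 / α) * m ^ α := by
  have hfin : ∀ b : ℝ, 0 ≤ b → ∫⁻ s in Set.Ioo (0 : ℝ) b, ENNReal.ofReal (s ^ (α - 1)) =
      ENNReal.ofReal (1 / α) * ENNReal.ofReal b ^ α := by
    intro b hb
    rw [← ofReal_integral_eq_lintegral_ofReal, ← integral_Ioc_eq_integral_Ioo,
      ← intervalIntegral.integral_of_le hb, integral_rpow (Or.inl (by linarith)),
      ENNReal.ofReal_rpow_of_nonneg hb hα.le, ← ENNReal.ofReal_mul (by positivity)]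
    · congr 1
      rw [sub_add_cancel, Real.zero_rpow hα.ne']
      ring
    · have := intervalIntegral.intervalIntegrable_rpow' (a := 0) (b := b) (r := α - 1) (by linarith)
      rw [intervalIntegrable_iff_integrableOn_Ioo_of_le hb] at this
      exact this
    · filter_upwards [ae_restrict_mem measurableSet_Ioo] with s hs
      exact Real.rpow_nonneg hs.1.le _
  by_cases hm : m = ⊤
  · subst hm
    rw [ENNReal.top_rpow_of_pos hα, ENNReal.mul_top (by simp; positivity), eq_top_iff]
    refine ENNReal.le_of_forall_nnreal_lt fun r _ => ?_
    -- The upper limit is chosen so that the truncated integral equals `r`.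
    have h1 := hfin ((α * r) ^ (1 / α)) (by positivity)
    rw [ENNReal.ofReal_rpow_of_nonneg (by positivity) hα.le, ← ENNReal.ofReal_mul (by positivity),
      ← Real.rpow_mul (by positivity), one_div_mul_cancel hα.ne', Real.rpow_one, ← mul_assoc,
      one_div_mul_cancel hα.ne', one_mul, ENNReal.ofReal_coe_nnreal] at h1
    rw [← h1]
    refine (lintegral_mono_set Set.Ioo_subset_Ioi_self).trans (lintegral_mono fun s => ?_)
    simp
  · lift m to NNReal using hm
    have h1 := hfin m m.2
    rw [ENNReal.ofReal_coe_nnreal] at h1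
    rw [← h1, ← lintegral_indicator measurableSet_Ioi, ← lintegral_indicator measurableSet_Ioo]
    congr 1
    ext s
    by_cases hs : 0 < s
    · have h2 : ENNReal.ofReal s < m ↔ s < m := ENNReal.ofReal_lt_coe_iff hs.le
      by_cases hsm : s < m <;> simp [Set.indicator_apply, hs, hsm, h2]
    · simp [Set.indicator_apply, hs]

theorem maxFn_congr_ae {f g : EuclideanSpace ℝ (Fin N) → ℝ≥0∞} (h : f =ᵐ[volume] g) :
    maxFn f = maxFn g := by
  ext x
  simp only [maxFn, ballAvg]
  congr! 4 with t
  exact lintegral_congr_ae (ae_restrict_of_ae h)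

/-- Marcinkiewicz interpolation with L^∞. At height `s`, the part of `g` below `s / W` contributes
at most `s / 2` to the maximal function, so the weak-type bound is applied to the rest only.
Integrating over `s` and using Tonelli leaves the integral of `s ^ (p - 2)` up to `g y * W`, which
converges at 0 since `p > 1`. -/
theorem lintegral_maxFn_rpow_le_of_measurable (hN : 0 < N) {p : ℝ} (hp : 1 < p)
    {g : EuclideanSpace ℝ (Fin N) → ℝ≥0∞} (hg : Measurable g) :
    ∫⁻ x, maxFn g x ^ p ≤ ENNReal.ofReal p * (2 * (ENNReal.ofReal (4 ^ (N : ℝ)) * unitBallVol N) *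
      (ENNReal.ofReal (1 / (p - 1)) * (2 * unitBallVol N) ^ (p - 1))) * ∫⁻ x, g x ^ p := by
  have hp0 : 0 < p := by linarith
  have hω0 : 2 * unitBallVol N ≠ 0 := mul_ne_zero (by simp) (unitBallVol_ne_zero N)
  have hωt : 2 * unitBallVol N ≠ ⊤ := ENNReal.mul_ne_top (by simp) (unitBallVol_ne_top N)
  set A := ENNReal.ofReal (4 ^ (N : ℝ)) * unitBallVol N with hA
  set W := 2 * unitBallVol N with hW
  have hmeas : ∀ {m : EuclideanSpace ℝ (Fin N) → ℝ≥0∞}, Measurable m → Measurable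
      fun z : EuclideanSpace ℝ (Fin N) × ℝ => ({s : ℝ | ENNReal.ofReal s < m z.1}.indicator 1 z.2 : ℝ≥0∞) := by
    intro m hm
    have : (fun z : EuclideanSpace ℝ (Fin N) × ℝ =>
        ({s : ℝ | ENNReal.ofReal s < m z.1}.indicator 1 z.2 : ℝ≥0∞)) =
        {z : EuclideanSpace ℝ (Fin N) × ℝ | ENNReal.ofReal z.2 < m z.1}.indicator 1 := by
      ext z; simp [Set.indicator_apply]
    rw [this]
    exact measurable_one.indicator (measurableSet_lt (by fun_prop) (by fun_prop))
  have hM := measurable_maxFn g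
  have hlevel : ∀ s : ℝ, 0 < s → ENNReal.ofReal s * volume {x | ENNReal.ofReal s < maxFn g x} ≤
      2 * A * ∫⁻ y, {s : ℝ | ENNReal.ofReal s < g y * W}.indicator 1 s * g y := by
    intro s hs
    have hsub : {x | ENNReal.ofReal s < maxFn g x} ⊆ {x | ENNReal.ofReal s / 2 <
        maxFn ({y | ENNReal.ofReal s / W < g y}.indicator g) x} := by
      intro x hx
      have h1 := maxFn_le_add_const g (ENNReal.ofReal s / W) x
      have h2 : ENNReal.ofReal s / W * unitBallVol N = ENNReal.ofReal s / 2 := by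
        rw [hW, div_eq_mul_inv, div_eq_mul_inv,
          ENNReal.mul_inv (Or.inl (by simp)) (Or.inl (by simp)), mul_assoc, mul_assoc,
          ENNReal.inv_mul_cancel (unitBallVol_ne_zero N) (unitBallVol_ne_top N), mul_one]
      rw [h2] at h1
      by_contra hcon
      rw [Set.mem_ofPred_eq, not_lt] at hcon
      have h4 := h1.trans (add_le_add_left hcon _)
      rw [ENNReal.add_halves] at h4
      exact absurd hx (not_lt.2 h4)
    have h5 := maxFn_weak_type hN ({y | ENNReal.ofReal s / W < g y}.indicator g)
      (s := ENNReal.ofReal s / 2) (by simp [hs]) (ENNReal.div_ne_top (by simp) (by simp))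
    calc _ = 2 * (ENNReal.ofReal s / 2 * volume {x | ENNReal.ofReal s < maxFn g x}) := by
          rw [← mul_assoc, ENNReal.mul_div_cancel (by simp) (by simp)]
      _ ≤ 2 * (A * ∫⁻ y, {y | ENNReal.ofReal s / W < g y}.indicator g y) := by
          refine mul_le_mul_right (le_trans ?_ h5) _
          exact mul_le_mul_right (measure_mono hsub) _
      _ = _ := by
          rw [← mul_assoc]
          congr 1
          refine lintegral_congr fun y => ?_
          have : ENNReal.ofReal s / W < g y ↔ ENNReal.ofReal s < g y * W :=
            ENNReal.div_lt_iff (Or.inl hω0) (Or.inl hωt)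
          simp [Set.indicator_apply, this]
  -- One factor `s` is split off for the weak-type estimate to absorb.
  have hps : ∀ s : ℝ, 0 < s →
      ENNReal.ofReal (s ^ (p - 1)) = ENNReal.ofReal (s ^ (p - 1 - 1)) * ENNReal.ofReal s := by
    intro s hs
    rw [← ENNReal.ofReal_mul (by positivity), ← Real.rpow_add_one hs.ne', sub_add_cancel]
  have hrep : ∀ x, maxFn g x ^ p = ENNReal.ofReal p * ∫⁻ s in Set.Ioi (0 : ℝ),
      ENNReal.ofReal (s ^ (p - 1)) * {s : ℝ | ENNReal.ofReal s < maxFn g x}.indicator 1 s := by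
    intro x
    rw [lintegral_Ioi_rpow_indicator hp0, ← mul_assoc, ← ENNReal.ofReal_mul hp0.le,
      mul_one_div_cancel hp0.ne', ENNReal.ofReal_one, one_mul]
  simp_rw [hrep]
  rw [lintegral_const_mul' _ _ (by simp), mul_assoc]
  gcongr
  rw [lintegral_lintegral_swap]
  swap
  · refine Measurable.aemeasurable ?_
    exact Measurable.mul (by fun_prop) (hmeas hM)
  calc ∫⁻ s in Set.Ioi (0 : ℝ), ∫⁻ x, ENNReal.ofReal (s ^ (p - 1)) *
        {s : ℝ | ENNReal.ofReal s < maxFn g x}.indicator 1 s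
      = ∫⁻ s in Set.Ioi (0 : ℝ), ENNReal.ofReal (s ^ (p - 1 - 1)) *
        (ENNReal.ofReal s * volume {x | ENNReal.ofReal s < maxFn g x}) := by
        refine setLIntegral_congr_fun measurableSet_Ioi fun s hs => ?_
        rw [lintegral_const_mul' _ _ (by simp), hps s hs, mul_assoc]
        congr 2
        rw [← lintegral_indicator_one (measurableSet_lt measurable_const hM)]
        simp [Set.indicator_apply]
    _ ≤ ∫⁻ s in Set.Ioi (0 : ℝ), ENNReal.ofReal (s ^ (p - 1 - 1)) *
        (2 * A * ∫⁻ y, {s : ℝ | ENNReal.ofReal s < g y * W}.indicator 1 s * g y) := by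
        refine setLIntegral_mono' measurableSet_Ioi fun s hs => ?_
        exact mul_le_mul_right (hlevel s hs) _
    _ = 2 * A * ∫⁻ s in Set.Ioi (0 : ℝ), ∫⁻ y, ENNReal.ofReal (s ^ (p - 1 - 1)) *
        ({s : ℝ | ENNReal.ofReal s < g y * W}.indicator 1 s * g y) := by
        rw [← lintegral_const_mul' _ _ (ENNReal.mul_ne_top (by simp)
          (ENNReal.mul_ne_top (by simp) (unitBallVol_ne_top N)))]
        congr 1
        ext s
        rw [lintegral_const_mul' _ _ (by simp)]
        ring
    _ = 2 * A * ∫⁻ y, (∫⁻ s in Set.Ioi (0 : ℝ), ENNReal.ofReal (s ^ (p - 1 - 1)) *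
        {s : ℝ | ENNReal.ofReal s < g y * W}.indicator 1 s) * g y := by
        rw [lintegral_lintegral_swap]
        · congr 2
          ext y
          rw [← lintegral_mul_const]
          · simp_rw [mul_assoc]
          · exact Measurable.mul (by fun_prop)
              ((hmeas (hg.mul_const W)).comp (measurable_const.prodMk measurable_id))
        · refine Measurable.aemeasurable ?_
          exact Measurable.mul (by fun_prop) (Measurable.mul
            ((hmeas (hg.mul_const W)).comp measurable_swap) (by fun_prop))
    _ = _ := by
        simp_rw [lintegral_Ioi_rpow_indicator (sub_pos.2 hp)]
        rw [mul_assoc (2 * A)]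
        congr 1
        rw [← lintegral_const_mul _ (by fun_prop)]
        congr 1
        ext y
        rw [ENNReal.mul_rpow_of_nonneg _ _ (by linarith)]
        have : g y ^ p = g y ^ (p - 1) * g y := by
          conv_lhs => rw [← sub_add_cancel p 1]
          rw [ENNReal.rpow_add_of_nonneg _ _ (by linarith) zero_le_one, ENNReal.rpow_one]
        rw [this]
        ring

/-- The Hardy–Littlewood maximal theorem in `L^p`. -/
theorem exists_lintegral_maxFn_rpow_le (hN : 0 < N) {p : ℝ} (hp : 1 < p) :
    ∃ C : ℝ≥0∞, C ≠ ⊤ ∧ ∀ g : EuclideanSpace ℝ (Fin N) → ℝ≥0∞, AEMeasurable g →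
      ∫⁻ x, maxFn g x ^ p ≤ C * ∫⁻ x, g x ^ p := by
  refine ⟨ENNReal.ofReal p * (2 * (ENNReal.ofReal (4 ^ (N : ℝ)) * unitBallVol N) *
      (ENNReal.ofReal (1 / (p - 1)) * (2 * unitBallVol N) ^ (p - 1))), ?_, fun g hg => ?_⟩
  rotate_left
  · rw [maxFn_congr_ae hg.ae_eq_mk]
    refine (lintegral_maxFn_rpow_le_of_measurable hN hp hg.measurable_mk).trans_eq ?_
    congr 1
    exact lintegral_congr_ae (hg.ae_eq_mk.mono fun x hx => by simp only [hx])
  · have := unitBallVol_ne_top N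
    have h2 : (2 * unitBallVol N) ^ (p - 1) ≠ ⊤ :=
      ENNReal.rpow_ne_top_of_nonneg (by linarith) (ENNReal.mul_ne_top (by simp) this)
    finiteness

/-- The maximal operator is bounded on Morrey spaces. -/
theorem exists_eMorrey_maxFn_le (hN : 0 < N) {lam p : ℝ} (hp : 1 < p)
    (hlamN : lam ≤ N) :
    ∃ C : ℝ≥0∞, C ≠ ⊤ ∧ ∀ g : EuclideanSpace ℝ (Fin N) → ℝ≥0∞, AEMeasurable g →
      eMorrey lam p (maxFn g) ≤ C * eMorrey lam p g := by
  have hp0 : 0 < p := by linarith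
  obtain ⟨C, hC, hmax⟩ := exists_lintegral_maxFn_rpow_le hN hp
  set K := unitBallVol N ^ (1 - 1 / p) with hK
  have hKt : K ≠ ⊤ := ENNReal.rpow_ne_top_of_nonneg
    (by rw [sub_nonneg, div_le_one hp0]; exact hp.le) (unitBallVol_ne_top N)
  set D : ℝ≥0∞ := 2 ^ (p - 1) * (C * ENNReal.ofReal (2 ^ lam) + K ^ p * unitBallVol N) with hD
  have hDt : D ≠ ⊤ := by
    have h1 := unitBallVol_ne_top N
    have h2 : K ^ p ≠ ⊤ := ENNReal.rpow_ne_top_of_nonneg hp0.le hKt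
    have h3 : (2 : ℝ≥0∞) ^ (p - 1) ≠ ⊤ := ENNReal.rpow_ne_top_of_nonneg (by linarith) (by simp)
    finiteness
  refine ⟨D ^ (1 / p), ENNReal.rpow_ne_top_of_nonneg (by positivity) hDt, fun g hg => ?_⟩
  refine eMorrey_le_of_forall hp0 fun x₀ ρ hρ => ?_
  -- For centres in B(x₀, ρ), averages of radius at most `ρ` see only `h`, which the L^p theorem
  -- handles. Larger radii are bounded by the constant `T` through the decay of averages, and `T ^
  -- p` times the volume of the ball again scales like `ρ ^ lam`.
  set h := (Metric.ball x₀ (2 * ρ)).indicator g with hh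
  set T := K * ENNReal.ofReal (ρ ^ (-((N - lam) / p))) * eMorrey lam p g with hT
  have hpt : ∀ x ∈ Metric.ball x₀ ρ, maxFn g x ≤ maxFn h x + T := by
    intro x hx
    refine iSup_le fun t => iSup_le fun ht => ?_
    by_cases htρ : t ≤ ρ
    · refine le_trans ?_ le_self_add
      refine le_trans (le_of_eq ?_) (ballAvg_le_maxFn h x ht)
      rw [ballAvg, ballAvg]
      congr 1
      refine setLIntegral_congr_fun measurableSet_ball fun y hy => ?_
      rw [hh, Set.indicator_of_mem]
      rw [Metric.mem_ball] at *
      linarith [dist_triangle y x x₀]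
    · refine le_trans ?_ le_add_self
      refine (ballAvg_le_eMorrey (lam := lam) hp.le hg x ht).trans ?_
      refine mul_le_mul_left (mul_le_mul_right (ENNReal.ofReal_le_ofReal ?_) _) _
      refine Real.rpow_le_rpow_of_nonpos hρ (not_le.1 htρ).le ?_
      rw [neg_nonpos]
      exact div_nonneg (by linarith) hp0.le
  have hTp : T ^ p = K ^ p * ENNReal.ofReal (ρ ^ (-(N - lam))) * eMorrey lam p g ^ p := by
    rw [hT, ENNReal.mul_rpow_of_nonneg _ _ hp0.le, ENNReal.mul_rpow_of_nonneg _ _ hp0.le,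
      ENNReal.ofReal_rpow_rpow hρ, neg_mul, div_mul_cancel₀ _ hp0.ne']
  calc ∫⁻ y in Metric.ball x₀ ρ, maxFn g y ^ p
      ≤ ∫⁻ y in Metric.ball x₀ ρ, 2 ^ (p - 1) * (maxFn h y ^ p + T ^ p) := by
        refine setLIntegral_mono' measurableSet_ball fun y hy => ?_
        refine le_trans ?_ (ENNReal.rpow_add_le_mul_rpow_add_rpow _ _ hp.le)
        gcongr
        exact hpt y hy
    _ = 2 ^ (p - 1) * ((∫⁻ y in Metric.ball x₀ ρ, maxFn h y ^ p) +
          T ^ p * volume (Metric.ball x₀ ρ)) := by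
        rw [lintegral_const_mul' _ _ (ENNReal.rpow_ne_top_of_nonneg (by linarith) (by simp)),
          lintegral_add_right _ measurable_const, lintegral_const, Measure.restrict_apply_univ]
    _ ≤ 2 ^ (p - 1) * (C * (ENNReal.ofReal ((2 * ρ) ^ lam) * eMorrey lam p g ^ p) +
          T ^ p * volume (Metric.ball x₀ ρ)) := by
        gcongr
        refine (setLIntegral_le_lintegral _ _).trans ((hmax h (hg.indicator measurableSet_ball)).trans ?_)
        gcongr
        refine le_trans (le_of_eq ?_) (setLIntegral_ball_le_eMorrey hp0 g x₀ (by positivity))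
        rw [← lintegral_indicator measurableSet_ball]
        congr 1
        ext y
        by_cases hy : y ∈ Metric.ball x₀ (2 * ρ) <;> simp [hh, hy, hp0]
    _ = 2 ^ (p - 1) * (C * (ENNReal.ofReal (2 ^ lam) * ENNReal.ofReal (ρ ^ lam) * eMorrey lam p g ^ p) +
          K ^ p * unitBallVol N * (ENNReal.ofReal (ρ ^ (-(N - lam))) * ENNReal.ofReal (ρ ^ (N : ℝ))) *
            eMorrey lam p g ^ p) := by
        rw [hTp, volume_ball_eq _ hρ, Real.mul_rpow (by norm_num) hρ.le,
          ENNReal.ofReal_mul (by positivity)]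
        ring
    _ = _ := by
        rw [ENNReal.ofReal_rpow_mul_cancel hρ, ENNReal.mul_rpow_of_nonneg _ _ hp0.le,
          ← ENNReal.rpow_mul D, one_div_mul_cancel hp0.ne', ENNReal.rpow_one,
          show -((N : ℝ) - lam) + N = lam by ring, hD]
        ring

end Maximal

/-! ### Riesz potentials: Hedberg's inequality and Adams' theorem -/

/-- The Riesz potential of order `γ`, written (up to a constant) as an integral of ball averages. -/
noncomputable def rieszJ {N : ℕ} (γ : ℝ) (g : EuclideanSpace ℝ (Fin N) → ℝ≥0∞)
    (x : EuclideanSpace ℝ (Fin N)) : ℝ≥0∞ :=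
  ∫⁻ t in Set.Ioi (0 : ℝ), ENNReal.ofReal (t ^ (γ - 1)) * ballAvg g x t

theorem lintegral_Ioc_rpow_sub_one {γ δ : ℝ} (hγ : 0 < γ) (hδ : 0 < δ) :
    ∫⁻ t in Set.Ioc (0 : ℝ) δ, ENNReal.ofReal (t ^ (γ - 1)) = ENNReal.ofReal (δ ^ γ / γ) := by
  rw [← ofReal_integral_eq_lintegral_ofReal, ← intervalIntegral.integral_of_le hδ.le,
    integral_rpow (Or.inl (by linarith)), sub_add_cancel, Real.zero_rpow hγ.ne', sub_zero]
  · exact (intervalIntegrable_iff_integrableOn_Ioc_of_le hδ.le).1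
      (intervalIntegral.intervalIntegrable_rpow' (by linarith))
  · filter_upwards [ae_restrict_mem measurableSet_Ioc] with s hs
    exact Real.rpow_nonneg hs.1.le _

theorem lintegral_Ioi_rpow_sub_one {β δ : ℝ} (hβ : β < 0) (hδ : 0 < δ) :
    ∫⁻ t in Set.Ioi δ, ENNReal.ofReal (t ^ (β - 1)) = ENNReal.ofReal (δ ^ β / (-β)) := by
  rw [← ofReal_integral_eq_lintegral_ofReal, integral_Ioi_rpow_of_lt (by linarith) hδ,
    sub_add_cancel, neg_div, div_neg]
  · exact integrableOn_Ioi_rpow_of_lt (by linarith) hδ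
  · filter_upwards [ae_restrict_mem measurableSet_Ioi] with s hs
    exact Real.rpow_nonneg (hδ.le.trans (le_of_lt hs)) _

theorem lintegral_Ioi_mul_le_split {γ κ : ℝ} (hγ : 0 < γ) (hκ : γ < κ) {A : ℝ → ℝ≥0∞}
    {M B : ℝ≥0∞} (hM : ∀ t, 0 < t → A t ≤ M)
    (hB : ∀ t, 0 < t → A t ≤ ENNReal.ofReal (t ^ (-κ)) * B) {δ : ℝ} (hδ : 0 < δ) :
    ∫⁻ t in Set.Ioi (0 : ℝ), ENNReal.ofReal (t ^ (γ - 1)) * A t ≤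
      ENNReal.ofReal (δ ^ γ / γ) * M + ENNReal.ofReal (δ ^ (γ - κ) / (κ - γ)) * B := by
  rw [← Set.Ioc_union_Ioi_eq_Ioi hδ.le]
  refine (lintegral_union_le _ _ _).trans (add_le_add ?_ ?_)
  · rw [← lintegral_Ioc_rpow_sub_one hγ hδ, ← lintegral_mul_const _ (by fun_prop)]
    refine setLIntegral_mono' measurableSet_Ioc fun t ht => ?_
    gcongr
    exact hM t ht.1
  · rw [show κ - γ = -(γ - κ) by ring, ← lintegral_Ioi_rpow_sub_one (by linarith) hδ,
      ← lintegral_mul_const _ (by fun_prop)]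
    refine setLIntegral_mono' measurableSet_Ioi fun t ht => ?_
    have ht0 : 0 < t := hδ.trans ht
    calc _ ≤ ENNReal.ofReal (t ^ (γ - 1)) * (ENNReal.ofReal (t ^ (-κ)) * B) := by
          gcongr; exact hB t ht0
      _ = _ := by
          rw [← mul_assoc, ENNReal.ofReal_rpow_mul_cancel ht0]
          congr 3
          ring

theorem lintegral_Ioi_mul_le_interpolate {γ κ : ℝ} (hγ : 0 < γ) (hκ : γ < κ) {A : ℝ → ℝ≥0∞}
    {M B : ℝ≥0∞} (hM : ∀ t, 0 < t → A t ≤ M)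
    (hB : ∀ t, 0 < t → A t ≤ ENNReal.ofReal (t ^ (-κ)) * B) :
    ∫⁻ t in Set.Ioi (0 : ℝ), ENNReal.ofReal (t ^ (γ - 1)) * A t ≤
      ENNReal.ofReal (1 / γ + 1 / (κ - γ)) * (M ^ (1 - γ / κ) * B ^ (γ / κ)) := by
  have hκ0 : 0 < κ := hγ.trans hκ
  have hθ0 : 0 < γ / κ := by positivity
  have hθ1 : 0 < 1 - γ / κ := by rw [sub_pos, div_lt_one hκ0]; exact hκ
  have hzero : (∀ t, 0 < t → A t = 0) →
      ∫⁻ t in Set.Ioi (0 : ℝ), ENNReal.ofReal (t ^ (γ - 1)) * A t = 0 := by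
    intro h
    rw [setLIntegral_congr_fun (g := fun _ => 0) measurableSet_Ioi
      (fun t ht => by rw [h t ht, mul_zero])]
    simp
  have hc : ENNReal.ofReal (1 / γ + 1 / (κ - γ)) ≠ 0 := by
    have : 0 < κ - γ := by linarith
    simp only [ne_eq, ENNReal.ofReal_eq_zero, not_le]
    positivity
  -- In the degenerate cases the balancing radius below is not a positive real. If a bound is 0 the
  -- left side vanishes; if both are nonzero and one is infinite, so is the right side.
  rcases eq_or_ne M 0 with rfl | hM0
  · rw [hzero fun t ht => le_antisymm (hM t ht) zero_le]; exact zero_le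
  rcases eq_or_ne B 0 with rfl | hB0
  · rw [hzero fun t ht => le_antisymm ((hB t ht).trans (by simp)) zero_le]; exact zero_le
  rcases eq_or_ne M ⊤ with rfl | hMt
  · rw [ENNReal.top_rpow_of_pos hθ1, ENNReal.top_mul, ENNReal.mul_top hc]
    · exact le_top
    · simp [ENNReal.rpow_eq_zero_iff, hB0, hθ0.not_gt]
  rcases eq_or_ne B ⊤ with rfl | hBt
  · rw [ENNReal.top_rpow_of_pos hθ0, ENNReal.mul_top, ENNReal.mul_top hc]
    · exact le_top
    · simp [ENNReal.rpow_eq_zero_iff, hM0, hθ1.not_gt]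
  lift M to NNReal using hMt
  lift B to NNReal using hBt
  have hm : (0 : ℝ) < M := by exact_mod_cast pos_iff_ne_zero.2 (by simpa using hM0)
  have hb : (0 : ℝ) < B := by exact_mod_cast pos_iff_ne_zero.2 (by simpa using hB0)
  -- This `δ` solves `δ ^ γ * M = δ ^ (γ - κ) * B`; `e1` and `e2` give the common value.
  refine (lintegral_Ioi_mul_le_split hγ hκ hM hB
    (δ := ((B : ℝ) / M) ^ (1 / κ)) (by positivity)).trans (le_of_eq ?_)
  have e1 : (((B : ℝ) / M) ^ (1 / κ)) ^ γ * M = (M : ℝ) ^ (1 - γ / κ) * (B : ℝ) ^ (γ / κ) := by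
    rw [← Real.rpow_mul (by positivity), Real.div_rpow hb.le hm.le, Real.rpow_sub hm, Real.rpow_one,
      one_div_mul_eq_div]
    ring
  have e2 : (((B : ℝ) / M) ^ (1 / κ)) ^ (γ - κ) * B = (M : ℝ) ^ (1 - γ / κ) * (B : ℝ) ^ (γ / κ) := by
    rw [← Real.rpow_mul (by positivity), Real.div_rpow hb.le hm.le,
      show 1 / κ * (γ - κ) = γ / κ - 1 by field_simp, Real.rpow_sub hm, Real.rpow_sub hb,
      Real.rpow_sub hm, Real.rpow_one, Real.rpow_one]
    field_simp
  have hκγ : 0 < κ - γ := by linarith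
  simp only [← ENNReal.ofReal_coe_nnreal]
  rw [ENNReal.ofReal_rpow_of_pos hm, ENNReal.ofReal_rpow_of_pos hb, ← ENNReal.ofReal_mul (by positivity),
    ← ENNReal.ofReal_mul (by positivity), ← ENNReal.ofReal_mul (by positivity),
    ← ENNReal.ofReal_mul (by positivity), ← ENNReal.ofReal_add (by positivity) (by positivity),
    div_mul_eq_mul_div, div_mul_eq_mul_div, e1, e2]
  congr 1
  ring

/-- Hedberg's inequality in Morrey spaces. -/
theorem rieszJ_le_maxFn {N : ℕ} {lam p γ : ℝ} (hp : 1 < p) (hγ : 0 < γ) (hlam : lam < N - γ * p)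
    {g : EuclideanSpace ℝ (Fin N) → ℝ≥0∞} (hg : AEMeasurable g) (x : EuclideanSpace ℝ (Fin N)) :
    rieszJ γ g x ≤ ENNReal.ofReal (1 / γ + 1 / ((N - lam) / p - γ)) *
      (maxFn g x ^ (1 - γ / ((N - lam) / p)) *
        (unitBallVol N ^ (1 - 1 / p) * eMorrey lam p g) ^ (γ / ((N - lam) / p))) := by
  refine lintegral_Ioi_mul_le_interpolate hγ ?_ (fun t ht => ballAvg_le_maxFn g x ht)
    (fun t ht => ?_)
  · rw [lt_div_iff₀ (by linarith)]; linarith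
  · refine (ballAvg_le_eMorrey (lam := lam) hp.le hg x ht).trans (le_of_eq ?_)
    ring

/-- Adams' theorem: the Riesz potential maps `M^lam_p` to `M^lam_s`. -/
theorem exists_eMorrey_rieszJ_le {N : ℕ} (hN : 0 < N) {lam p γ s : ℝ} (hp : 1 < p) (hγ : 0 < γ)
    (hlam : lam < N - γ * p) (hs : 1 / s = 1 / p - γ / (N - lam)) :
    ∃ C : ℝ≥0∞, C ≠ ⊤ ∧ ∀ g : EuclideanSpace ℝ (Fin N) → ℝ≥0∞, AEMeasurable g →
      eMorrey lam s (rieszJ γ g) ≤ C * eMorrey lam p g := by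
  have hp0 : 0 < p := by linarith
  have hNl : 0 < N - lam := by nlinarith
  have hs0 : 0 < s := by
    rw [← one_div_pos, hs, sub_pos, div_lt_div_iff₀ hNl hp0]
    linarith
  set θ := γ / ((N - lam) / p) with hθ
  have hθ0 : 0 < θ := by positivity
  -- The choice of `s` is what makes the `s`-th power of Hedberg's bound contain exactly the `p`-th
  -- power of the maximal function.
  have hθ1 : 1 - θ = p / s := by
    rw [div_eq_mul_one_div, hs, hθ]
    field_simp
  have hsum : θ * s + p = s := by
    have : θ = 1 - p / s := by linarith
    rw [this]; field_simp; ring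
  obtain ⟨C, hC, hmax⟩ := exists_eMorrey_maxFn_le hN (lam := lam) hp (by nlinarith)
  set c := ENNReal.ofReal (1 / γ + 1 / ((N - lam) / p - γ)) with hc
  set K := unitBallVol N ^ (1 - 1 / p) with hK
  have hKt : K ≠ ⊤ := ENNReal.rpow_ne_top_of_nonneg
    (by rw [sub_nonneg, div_le_one hp0]; exact hp.le) (unitBallVol_ne_top N)
  refine ⟨c * (K ^ θ * C ^ (p / s)), ?_, fun g hg => eMorrey_le_of_forall hs0 fun x ρ hρ => ?_⟩
  · have h1 : K ^ θ ≠ ⊤ := ENNReal.rpow_ne_top_of_nonneg hθ0.le hKt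
    have h2 : C ^ (p / s) ≠ ⊤ := ENNReal.rpow_ne_top_of_nonneg (by positivity) hC
    finiteness
  set E := eMorrey lam p g with hE
  have hpt : ∀ y, rieszJ γ g y ^ s ≤ (c ^ s * (K * E) ^ (θ * s)) * maxFn g y ^ p := by
    intro y
    calc rieszJ γ g y ^ s ≤ (c * (maxFn g y ^ (1 - θ) * (K * E) ^ θ)) ^ s := by
          gcongr
          exact rieszJ_le_maxFn hp hγ hlam hg y
      _ = _ := by
          rw [ENNReal.mul_rpow_of_nonneg _ _ hs0.le, ENNReal.mul_rpow_of_nonneg _ _ hs0.le,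
            ← ENNReal.rpow_mul, ← ENNReal.rpow_mul, hθ1, div_mul_cancel₀ _ hs0.ne']
          ring
  calc ∫⁻ y in Metric.ball x ρ, rieszJ γ g y ^ s
      ≤ ∫⁻ y in Metric.ball x ρ, (c ^ s * (K * E) ^ (θ * s)) * maxFn g y ^ p :=
        lintegral_mono hpt
    _ = (c ^ s * (K * E) ^ (θ * s)) * ∫⁻ y in Metric.ball x ρ, maxFn g y ^ p :=
        lintegral_const_mul _ ((measurable_maxFn g).pow_const _)
    _ ≤ (c ^ s * (K * E) ^ (θ * s)) * (ENNReal.ofReal (ρ ^ lam) * (C * E) ^ p) := by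
        gcongr
        refine (setLIntegral_ball_le_eMorrey (lam := lam) hp0 _ x hρ).trans ?_
        gcongr
        exact hmax g hg
    _ = ENNReal.ofReal (ρ ^ lam) * (c ^ s * (K ^ (θ * s) * C ^ p) * (E ^ (θ * s) * E ^ p)) := by
        rw [ENNReal.mul_rpow_of_nonneg _ _ hp0.le, ENNReal.mul_rpow_of_nonneg _ _ (by positivity)]
        ring
    _ = _ := by
        rw [← ENNReal.rpow_add_of_nonneg _ _ (by positivity) hp0.le, hsum,
          ENNReal.mul_rpow_of_nonneg _ _ hs0.le, ENNReal.mul_rpow_of_nonneg _ _ hs0.le,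
          ENNReal.mul_rpow_of_nonneg _ _ hs0.le, ← ENNReal.rpow_mul K, ← ENNReal.rpow_mul C,
          div_mul_cancel₀ _ hs0.ne']

/-! ### Smooth functions dominated by the Riesz potential of their gradient -/

open scoped Convolution

section Smooth

variable {N : ℕ}

theorem lintegral_unitBall_comp_add_smul (F : EuclideanSpace ℝ (Fin N) → ℝ≥0∞)
    (x : EuclideanSpace ℝ (Fin N)) {t : ℝ} (ht : 0 < t) :
    ∫⁻ z in Metric.ball 0 1, F (x + t • z) = ballAvg F x t := by
  have hpre : Metric.ball (0 : EuclideanSpace ℝ (Fin N)) 1 =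
      (fun z => t • z) ⁻¹' ((fun z => x + z) ⁻¹' Metric.ball x t) := by
    ext z
    simp [norm_smul, abs_of_pos ht, ht]
  have hemb : MeasurableEmbedding (fun z : EuclideanSpace ℝ (Fin N) => t • z) :=
    (Homeomorph.smulOfNeZero t ht.ne').measurableEmbedding
  rw [hpre, ← hemb.lintegral_map (fun w => F (x + w)), ← hemb.restrict_map, Measure.map_addHaar_smul _ ht.ne', Measure.restrict_smul,
    lintegral_smul_measure, ballAvg, (measurePreserving_add_left volume x).setLIntegral_comp_preimage_emb
      (measurableEmbedding_addLeft x)]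
  rw [smul_eq_mul]
  congr 2
  rw [finrank_euclideanSpace_fin, Real.rpow_neg ht.le, Real.rpow_natCast, abs_of_pos (by positivity)]

theorem enorm_sub_le_lintegral_fderiv {v : EuclideanSpace ℝ (Fin N) → ℝ} (hv : ContDiff ℝ 1 v)
    (x : EuclideanSpace ℝ (Fin N)) {z : EuclideanSpace ℝ (Fin N)} (hz : ‖z‖ ≤ 1) {R : ℝ}
    (hR : 0 ≤ R) :
    ‖v x‖ₑ ≤ ‖v (x + R • z)‖ₑ + ∫⁻ t in Set.Ioc 0 R, ‖fderiv ℝ v (x + t • z)‖ₑ := by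
  have hd : ∀ t : ℝ, HasDerivAt (fun t : ℝ => v (x + t • z)) (fderiv ℝ v (x + t • z) z) t := by
    intro t
    have h1 : HasDerivAt (fun t : ℝ => x + t • z) z t := by
      simpa using ((hasDerivAt_id t).smul_const z).const_add x
    exact ((hv.differentiable one_ne_zero (x + t • z)).hasFDerivAt).comp_hasDerivAt t h1
  have hc : Continuous fun t : ℝ => fderiv ℝ v (x + t • z) z := by
    have := hv.continuous_fderiv one_ne_zero
    fun_prop
  have h := intervalIntegral.integral_eq_sub_of_hasDerivAt (fun t _ => hd t)
    (hc.intervalIntegrable 0 R)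
  rw [intervalIntegral.integral_of_le hR] at h
  have h2 : v x = v (x + R • z) - ∫ t in Set.Ioc 0 R, fderiv ℝ v (x + t • z) z := by
    rw [h]; simp
  calc ‖v x‖ₑ ≤ ‖v (x + R • z)‖ₑ + ‖∫ t in Set.Ioc 0 R, fderiv ℝ v (x + t • z) z‖ₑ := by
        conv_lhs => rw [h2]
        exact enorm_sub_le
    _ ≤ _ := by
        gcongr
        refine (enorm_integral_le_lintegral_enorm _).trans (lintegral_mono fun t => ?_)
        rw [← ofReal_norm, ← ofReal_norm]
        refine ENNReal.ofReal_le_ofReal ((ContinuousLinearMap.le_opNorm _ _).trans ?_)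
        exact mul_le_of_le_one_right (norm_nonneg _) hz

/-- Integrate the ray estimate over all `z` in the unit ball. For fixed `t`, the points `x + t • z`
fill B(x, t), so the `z`-integral is a ball average, and the `t`-integral is a truncated Riesz
potential of order 1. Using the solid ball instead of the sphere avoids polar coordinates. -/
theorem enorm_mul_unitBallVol_le {v : EuclideanSpace ℝ (Fin N) → ℝ} (hv : ContDiff ℝ 1 v)
    (x : EuclideanSpace ℝ (Fin N)) {R : ℝ} (hR : 0 < R) :
    ‖v x‖ₑ * unitBallVol N ≤
      ballAvg (fun y => ‖v y‖ₑ) x R + rieszJ 1 (fun y => ‖fderiv ℝ v y‖ₑ) x := by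
  have hcv := hv.continuous
  have hcd := hv.continuous_fderiv one_ne_zero
  calc ‖v x‖ₑ * unitBallVol N
      = ∫⁻ z in Metric.ball (0 : EuclideanSpace ℝ (Fin N)) 1, ‖v x‖ₑ := by
        rw [lintegral_const, Measure.restrict_apply_univ]; rfl
    _ ≤ ∫⁻ z in Metric.ball (0 : EuclideanSpace ℝ (Fin N)) 1, (‖v (x + R • z)‖ₑ +
          ∫⁻ t in Set.Ioc 0 R, ‖fderiv ℝ v (x + t • z)‖ₑ) := by
        refine setLIntegral_mono' measurableSet_ball fun z hz => ?_
        exact enorm_sub_le_lintegral_fderiv hv x (mem_ball_zero_iff.1 hz).le hR.le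
    _ = ballAvg (fun y => ‖v y‖ₑ) x R + ∫⁻ t in Set.Ioc 0 R,
          ∫⁻ z in Metric.ball (0 : EuclideanSpace ℝ (Fin N)) 1, ‖fderiv ℝ v (x + t • z)‖ₑ := by
        rw [lintegral_add_left (Continuous.measurable (by fun_prop)), lintegral_unitBall_comp_add_smul (fun y => ‖v y‖ₑ) x hR,
          lintegral_lintegral_swap]
        refine Continuous.aemeasurable ?_
        fun_prop
    _ = ballAvg (fun y => ‖v y‖ₑ) x R + ∫⁻ t in Set.Ioc 0 R, ENNReal.ofReal (t ^ ((1 : ℝ) - 1)) *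
          ballAvg (fun y => ‖fderiv ℝ v y‖ₑ) x t := by
        congr 1
        refine setLIntegral_congr_fun measurableSet_Ioc fun t ht => ?_
        rw [lintegral_unitBall_comp_add_smul (fun y => ‖fderiv ℝ v y‖ₑ) x ht.1]
        simp
    _ ≤ _ := by
        gcongr
        exact lintegral_mono_set Set.Ioc_subset_Ioi_self

/-- Let R → ∞: the average of `v` decays like R^(-(N-lam)/r). Finiteness of the Morrey norm is what
excludes nonzero constants. -/
theorem enorm_mul_unitBallVol_le_rieszJ {lam r : ℝ} (hr : 1 ≤ r) (hlam : lam < N)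
    {v : EuclideanSpace ℝ (Fin N) → ℝ} (hv : ContDiff ℝ 1 v)
    (hfin : eMorrey lam r (fun y => ‖v y‖ₑ) ≠ ⊤) (x : EuclideanSpace ℝ (Fin N)) :
    ‖v x‖ₑ * unitBallVol N ≤ rieszJ 1 (fun y => ‖fderiv ℝ v y‖ₑ) x := by
  have hcv := hv.continuous
  have hr0 : 0 < r := by linarith
  have hK : unitBallVol N ^ (1 - 1 / r) ≠ ⊤ := ENNReal.rpow_ne_top_of_nonneg
    (by rw [sub_nonneg, div_le_one hr0]; exact hr) (unitBallVol_ne_top N)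
  have hpos : 0 < (N - lam) / r := div_pos (by linarith) hr0
  have hlim : Filter.Tendsto (fun R : ℝ => unitBallVol N ^ (1 - 1 / r) *
      ENNReal.ofReal (R ^ (-((N - lam) / r))) * eMorrey lam r (fun y => ‖v y‖ₑ) +
      rieszJ 1 (fun y => ‖fderiv ℝ v y‖ₑ) x) Filter.atTop
      (nhds (unitBallVol N ^ (1 - 1 / r) * ENNReal.ofReal 0 * eMorrey lam r (fun y => ‖v y‖ₑ) +
        rieszJ 1 (fun y => ‖fderiv ℝ v y‖ₑ) x)) := by
    refine Filter.Tendsto.add_const _ (ENNReal.Tendsto.mul_const (ENNReal.Tendsto.const_mul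
      (ENNReal.tendsto_ofReal (tendsto_rpow_neg_atTop hpos)) (Or.inr hK)) (Or.inr hfin))
  rw [ENNReal.ofReal_zero, mul_zero, zero_mul, zero_add] at hlim
  refine ge_of_tendsto hlim ?_
  filter_upwards [Filter.eventually_gt_atTop 0] with R hR
  refine (enorm_mul_unitBallVol_le hv x hR).trans ?_
  gcongr
  exact ballAvg_le_eMorrey hr (by fun_prop) x hR

end Smooth

/-! ### Mollification and weak gradients -/

section Mollify

variable {N : ℕ} {lam p : ℝ}

/-- Jensen for the probability density `ψ`, obtained from Hölder by splitting `ψ` as `ψ ^ (1 / p) *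
ψ ^ (1 - 1 / p)`; this also covers `p = 1`. -/
theorem lintegral_mul_rpow_le {α : Type*} [MeasurableSpace α] {μ : Measure α} (hp : 1 ≤ p)
    {ψ g : α → ℝ≥0∞} (hψ : AEMeasurable ψ μ) (hψ1 : ∫⁻ t, ψ t ∂μ = 1) (hg : AEMeasurable g μ) :
    (∫⁻ t, ψ t * g t ∂μ) ^ p ≤ ∫⁻ t, ψ t * g t ^ p ∂μ := by
  have hp0 : 0 < p := by linarith
  have h1 : 0 ≤ 1 - 1 / p := by rw [sub_nonneg, div_le_one hp0]; exact hp
  have h := ENNReal.lintegral_mul_norm_pow_le (μ := μ) (f := fun t => ψ t * g t ^ p) (g := ψ)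
    (hψ.mul (hg.pow_const p)) hψ (p := 1 / p) (q := 1 - 1 / p) (by positivity) h1 (by ring)
  rw [hψ1, ENNReal.one_rpow, mul_one] at h
  have h2 : ∀ t, (ψ t * g t ^ p) ^ (1 / p) * ψ t ^ (1 - 1 / p) = ψ t * g t := by
    intro t
    rw [ENNReal.mul_rpow_of_nonneg _ _ (by positivity), ← ENNReal.rpow_mul,
      mul_one_div_cancel hp0.ne', ENNReal.rpow_one, mul_right_comm,
      ← ENNReal.rpow_add_of_nonneg _ _ (by positivity) h1]
    simp
  simp_rw [h2] at h
  calc _ ≤ ((∫⁻ t, ψ t * g t ^ p ∂μ) ^ (1 / p)) ^ p := by gcongr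
    _ = _ := by rw [← ENNReal.rpow_mul, one_div_mul_cancel hp0.ne', ENNReal.rpow_one]

/-- After Jensen and Tonelli, translation by `t` only moves the centre of the ball, and the Morrey
bound is uniform in the centre. -/
theorem eMorrey_lintegral_conv_le (hp : 1 ≤ p) {ψ g : EuclideanSpace ℝ (Fin N) → ℝ≥0∞}
    (hψ : Measurable ψ) (hψ1 : ∫⁻ t, ψ t = 1) (hg : AEMeasurable g) :
    eMorrey lam p (fun x => ∫⁻ t, ψ t * g (x - t)) ≤ eMorrey lam p g := by
  wlog hgm : Measurable g generalizing g
  · have h1 : ∀ x, ∫⁻ t, ψ t * g (x - t) = ∫⁻ t, ψ t * hg.mk g (x - t) := by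
      intro x
      refine lintegral_congr_ae ?_
      have := (quasiMeasurePreserving_sub_left volume x).ae_eq_comp hg.ae_eq_mk
      filter_upwards [this] with t ht
      simp only [Function.comp] at ht
      rw [ht]
    simp_rw [h1]
    exact (this hg.measurable_mk.aemeasurable hg.measurable_mk).trans
      (eMorrey_mono_ae (by linarith) (hg.ae_eq_mk.symm.mono fun x hx => hx.le))
  have hp0 : 0 < p := by linarith
  refine eMorrey_le_of_forall hp0 fun x₀ ρ hρ => ?_
  calc ∫⁻ x in Metric.ball x₀ ρ, (∫⁻ t, ψ t * g (x - t)) ^ p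
      ≤ ∫⁻ x in Metric.ball x₀ ρ, ∫⁻ t, ψ t * g (x - t) ^ p :=
        lintegral_mono fun x => lintegral_mul_rpow_le hp hψ.aemeasurable hψ1 (by fun_prop)
    _ = ∫⁻ t, ∫⁻ x in Metric.ball x₀ ρ, ψ t * g (x - t) ^ p :=
        lintegral_lintegral_swap (Measurable.aemeasurable (by fun_prop))
    _ = ∫⁻ t, ψ t * ∫⁻ x in Metric.ball (x₀ - t) ρ, g x ^ p := by
        refine lintegral_congr fun t => ?_
        rw [lintegral_const_mul _ (by fun_prop)]
        congr 1
        have hpre : Metric.ball x₀ ρ = (fun x => x - t) ⁻¹' Metric.ball (x₀ - t) ρ := by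
          ext x; simp [dist_eq_norm]
        rw [hpre]
        exact (measurePreserving_sub_right volume t).setLIntegral_comp_preimage measurableSet_ball
          (hgm.pow_const p)
    _ ≤ ∫⁻ t, ψ t * (ENNReal.ofReal (ρ ^ lam) * eMorrey lam p g ^ p) := by
        gcongr with t
        exact setLIntegral_ball_le_eMorrey hp0 g _ hρ
    _ = _ := by rw [lintegral_mul_const _ hψ, hψ1, one_mul]

theorem eMorrey_convolution_le {F : Type*} [NormedAddCommGroup F] [NormedSpace ℝ F] (hp : 1 ≤ p)
    (φ : ContDiffBump (0 : EuclideanSpace ℝ (Fin N))) {f : EuclideanSpace ℝ (Fin N) → F}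
    (hf : AEStronglyMeasurable f volume) :
    eMorrey lam p (fun x => ‖(φ.normed volume ⋆[ContinuousLinearMap.lsmul ℝ ℝ, volume] f) x‖ₑ) ≤
      eMorrey lam p (fun x => ‖f x‖ₑ) := by
  have hφ : Measurable fun t => ‖φ.normed volume t‖ₑ :=
    (φ.continuous_normed (μ := volume)).enorm.measurable
  have hφ1 : ∫⁻ t, ‖φ.normed volume t‖ₑ = 1 := by
    simp_rw [Real.enorm_of_nonneg (φ.nonneg_normed _)]
    rw [← ofReal_integral_eq_lintegral_ofReal φ.integrable_normed
      (Filter.Eventually.of_forall fun x => φ.nonneg_normed x), φ.integral_normed, ENNReal.ofReal_one]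
  refine le_trans (eMorrey_mono_ae (by linarith) (Filter.Eventually.of_forall fun x => ?_))
    (eMorrey_lintegral_conv_le hp hφ hφ1 hf.enorm)
  rw [convolution_def]
  refine (enorm_integral_le_lintegral_enorm _).trans (lintegral_mono fun t => ?_)
  simp [enorm_smul]

/-- Test the weak gradient against `y ↦ φ (x - y)`: the sign from differentiating `x - y` cancels
the sign of integration by parts. -/
theorem fderiv_convolution_apply_of_hasWeakGradient {u : EuclideanSpace ℝ (Fin N) → ℝ}
    {G : EuclideanSpace ℝ (Fin N) → EuclideanSpace ℝ (Fin N)} (h : HasWeakGradient u G)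
    (φ : ContDiffBump (0 : EuclideanSpace ℝ (Fin N))) (x v : EuclideanSpace ℝ (Fin N)) :
    fderiv ℝ (φ.normed volume ⋆[ContinuousLinearMap.lsmul ℝ ℝ, volume] u) x v =
      inner ℝ ((φ.normed volume ⋆[ContinuousLinearMap.lsmul ℝ ℝ, volume] G) x) v := by
  have hcs : HasCompactSupport (φ.normed volume) := φ.hasCompactSupport_normed
  have hcd : ContDiff ℝ ∞ (φ.normed volume) := φ.contDiff_normed
  have hd := HasCompactSupport.hasFDerivAt_convolution_left (ContinuousLinearMap.lsmul ℝ ℝ) hcs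
    (hcd.of_le (by exact_mod_cast le_top)) h.locallyIntegrable x
  rw [hd.fderiv, convolution_def, convolution_def]
  have hex : Integrable (fun t => ((ContinuousLinearMap.lsmul ℝ ℝ).precompL
      (EuclideanSpace ℝ (Fin N)) (fderiv ℝ (φ.normed volume) t)) (u (x - t))) volume :=
    HasCompactSupport.convolutionExists_left _ (hcs.fderiv ℝ)
      (hcd.continuous_fderiv (by simp)) h.locallyIntegrable x
  have hexG : Integrable (fun t => (ContinuousLinearMap.lsmul ℝ ℝ (φ.normed volume t)) (G (x - t)))
      volume :=
    HasCompactSupport.convolutionExists_left _ hcs hcd.continuous h.locallyIntegrable_grad x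
  rw [ContinuousLinearMap.integral_apply hex, real_inner_comm, ← integral_inner hexG]
  have hη : ContDiff ℝ ∞ (fun y => φ.normed volume (x - y)) := by fun_prop
  have hηc : HasCompactSupport (fun y => φ.normed volume (x - y)) :=
    hcs.comp_homeomorph (Homeomorph.subLeft x)
  have hw := h.integral_eq _ hη hηc v
  have hfd : ∀ y, fderiv ℝ (fun y => φ.normed volume (x - y)) y v =
      - fderiv ℝ (φ.normed volume) (x - y) v := by
    intro y
    have h1 : HasFDerivAt (fun y : EuclideanSpace ℝ (Fin N) => x - y)
        (-ContinuousLinearMap.id ℝ (EuclideanSpace ℝ (Fin N))) y :=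
      (hasFDerivAt_id y).const_sub x
    have h2 := ((hcd.differentiable (by simp) (x - y)).hasFDerivAt).comp y h1
    have h3 : fderiv ℝ (fun y => φ.normed volume (x - y)) y = _ := h2.fderiv
    rw [h3]; simp
  simp_rw [hfd, mul_neg, integral_neg, neg_inj] at hw
  rw [← integral_sub_left_eq_self _ volume x,
    ← integral_sub_left_eq_self (fun t => inner ℝ v _) volume x]
  simp only [sub_sub_cancel]
  convert hw using 2
  · ext y; simp [ContinuousLinearMap.precompL_apply, mul_comm]
  · ext y; simp [inner_smul_right, real_inner_comm]

theorem enorm_fderiv_convolution_le {u : EuclideanSpace ℝ (Fin N) → ℝ}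
    {G : EuclideanSpace ℝ (Fin N) → EuclideanSpace ℝ (Fin N)} (h : HasWeakGradient u G)
    (φ : ContDiffBump (0 : EuclideanSpace ℝ (Fin N))) (x : EuclideanSpace ℝ (Fin N)) :
    ‖fderiv ℝ (φ.normed volume ⋆[ContinuousLinearMap.lsmul ℝ ℝ, volume] u) x‖ₑ ≤
      ‖(φ.normed volume ⋆[ContinuousLinearMap.lsmul ℝ ℝ, volume] G) x‖ₑ := by
  rw [← ofReal_norm, ← ofReal_norm]
  refine ENNReal.ofReal_le_ofReal (ContinuousLinearMap.opNorm_le_bound _ (norm_nonneg _) fun v => ?_)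
  rw [fderiv_convolution_apply_of_hasWeakGradient h]
  exact norm_inner_le_norm _ _

/-- Fatou on each ball. -/
theorem eMorrey_le_of_tendsto (hp : 0 < p) {f : ℕ → EuclideanSpace ℝ (Fin N) → ℝ≥0∞}
    {g : EuclideanSpace ℝ (Fin N) → ℝ≥0∞} {K : ℝ≥0∞} (hf : ∀ n, AEMeasurable (f n))
    (hlim : ∀ᵐ x, Filter.Tendsto (fun n => f n x) Filter.atTop (nhds (g x)))
    (hK : ∀ n, eMorrey lam p (f n) ≤ K) : eMorrey lam p g ≤ K := by
  refine eMorrey_le_of_forall hp fun x ρ hρ => ?_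
  calc ∫⁻ y in Metric.ball x ρ, g y ^ p
      = ∫⁻ y in Metric.ball x ρ, Filter.liminf (fun n => f n y ^ p) Filter.atTop := by
        refine lintegral_congr_ae ((ae_restrict_of_ae hlim).mono fun y hy => ?_)
        exact ((ENNReal.continuous_rpow_const.tendsto _).comp hy).liminf_eq.symm
    _ ≤ Filter.liminf (fun n => ∫⁻ y in Metric.ball x ρ, f n y ^ p) Filter.atTop :=
        lintegral_liminf_le' fun n => ((hf n).restrict.pow_const _)
    _ ≤ _ := by
        refine Filter.liminf_le_of_frequently_le' (Filter.Frequently.of_forall fun n => ?_)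
        refine (setLIntegral_ball_le_eMorrey (lam := lam) hp _ x hρ).trans ?_
        gcongr
        exact hK n

/-- The Sobolev inequality in Morrey spaces for weakly differentiable functions. -/
theorem exists_eMorrey_le_weakGradient {r s : ℝ} (hp : 1 < p) (hr : 1 ≤ r) (hpN : p < N)
    (hlam : lam < N - p) (hs : 1 / s = 1 / p - 1 / (N - lam)) :
    ∃ C : ℝ≥0∞, C ≠ ⊤ ∧ ∀ (u : EuclideanSpace ℝ (Fin N) → ℝ)
      (G : EuclideanSpace ℝ (Fin N) → EuclideanSpace ℝ (Fin N)),
      eMorrey lam r (fun x => ‖u x‖ₑ) ≠ ⊤ → HasWeakGradient u G →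
        eMorrey lam s (fun x => ‖u x‖ₑ) ≤ C * eMorrey lam p (fun x => ‖G x‖ₑ) := by
  have hN : 0 < N := by
    have : (0 : ℝ) < N := by linarith
    exact_mod_cast this
  have hs0 : 0 < s := by
    rw [← one_div_pos, hs, sub_pos, div_lt_div_iff₀ (by linarith) (by linarith)]
    linarith
  obtain ⟨C, hC, hadams⟩ := exists_eMorrey_rieszJ_le hN (lam := lam) (γ := 1) hp one_pos
    (by linarith) hs
  have hω := ENNReal.inv_ne_top.2 (unitBallVol_ne_zero N)
  refine ⟨(unitBallVol N)⁻¹ * C, by finiteness, fun u G hu h => ?_⟩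
  -- The ratio of outer to inner radius is fixed at 2, as the almost everywhere convergence of the
  -- mollifications requires a bounded ratio.
  let φ : ℕ → ContDiffBump (0 : EuclideanSpace ℝ (Fin N)) := fun n =>
    ⟨1 / (n + 1 : ℝ), 2 * (1 / (n + 1 : ℝ)), by positivity, by
      have : (0 : ℝ) < 1 / (n + 1 : ℝ) := by positivity
      linarith⟩
  have hφ : Filter.Tendsto (fun n => (φ n).rOut) Filter.atTop (nhds 0) := by
    have h0 := (tendsto_one_div_add_atTop_nhds_zero_nat (𝕜 := ℝ)).const_mul 2
    rwa [mul_zero] at h0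
  have hlim := ContDiffBump.ae_convolution_tendsto_right_of_locallyIntegrable (K := 2) hφ
    (Filter.Eventually.of_forall fun n => le_rfl) h.locallyIntegrable
  have hsm : ∀ n, ContDiff ℝ 1 ((φ n).normed volume ⋆[ContinuousLinearMap.lsmul ℝ ℝ, volume] u) :=
    fun n => HasCompactSupport.contDiff_convolution_left _ (φ n).hasCompactSupport_normed
      (φ n).contDiff_normed h.locallyIntegrable
  refine eMorrey_le_of_tendsto hs0
    (f := fun n x => ‖((φ n).normed volume ⋆[ContinuousLinearMap.lsmul ℝ ℝ, volume] u) x‖ₑ)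
    (fun n => (hsm n).continuous.enorm.aemeasurable) (hlim.mono fun x hx => hx.enorm) fun n => ?_
  -- The M^lam_r norm enters only qualitatively: its finiteness removes the term at infinity for
  -- each mollification, and it does not affect the constant.
  have humor := eMorrey_convolution_le (lam := lam) hr (φ n) h.locallyIntegrable.aestronglyMeasurable
  have hpt : ∀ x, ‖((φ n).normed volume ⋆[ContinuousLinearMap.lsmul ℝ ℝ, volume] u) x‖ₑ ≤
      (unitBallVol N)⁻¹ * rieszJ 1 (fun y =>
        ‖fderiv ℝ ((φ n).normed volume ⋆[ContinuousLinearMap.lsmul ℝ ℝ, volume] u) y‖ₑ) x := by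
    intro x
    rw [mul_comm, ← div_eq_mul_inv, ENNReal.le_div_iff_mul_le (Or.inl (unitBallVol_ne_zero N))
      (Or.inl (unitBallVol_ne_top N))]
    exact enorm_mul_unitBallVol_le_rieszJ hr (by linarith) (hsm n) (ne_top_of_le_ne_top hu humor) x
  have hgrad := eMorrey_convolution_le (lam := lam) hp.le (φ n)
    h.locallyIntegrable_grad.aestronglyMeasurable
  calc _ ≤ eMorrey lam s (fun x => (unitBallVol N)⁻¹ * rieszJ 1 (fun y =>
        ‖fderiv ℝ ((φ n).normed volume ⋆[ContinuousLinearMap.lsmul ℝ ℝ, volume] u) y‖ₑ) x) :=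
        eMorrey_mono_ae hs0 (Filter.Eventually.of_forall hpt)
    _ ≤ (unitBallVol N)⁻¹ * eMorrey lam s (rieszJ 1 (fun y =>
        ‖fderiv ℝ ((φ n).normed volume ⋆[ContinuousLinearMap.lsmul ℝ ℝ, volume] u) y‖ₑ)) :=
        eMorrey_const_mul_le hs0 _ hω
    _ ≤ (unitBallVol N)⁻¹ * (C * eMorrey lam p (fun x => ‖G x‖ₑ)) := by
        gcongr
        refine (hadams _ ((hsm n).continuous_fderiv one_ne_zero).enorm.aemeasurable).trans ?_
        gcongr
        refine le_trans (eMorrey_mono_ae (by linarith) (Filter.Eventually.of_forall fun x => ?_)) hgrad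
        exact enorm_fderiv_convolution_le h (φ n) x
    _ = _ := by ring

end Mollify

/-! ### The kernel integral behind the fractional symbol -/

open scoped FourierTransform RealInnerProductSpace

section Kernel

variable {N : ℕ}

/-- In polar coordinates: near 0 the quadratic bound on 1 - cos leaves r^(1-γ), integrable as γ < 2;
near infinity boundedness of the numerator leaves r^(-1-γ), integrable as γ > 0. -/
theorem integrable_fracKernel (hN : 0 < N) {γ : ℝ} (hγ : 0 < γ) (hγ2 : γ < 2)
    (ξ : EuclideanSpace ℝ (Fin N)) :
    Integrable (fun y : EuclideanSpace ℝ (Fin N) =>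
      (2 - 2 * Real.cos (2 * Real.pi * ⟪ξ, y⟫)) / ‖y‖ ^ ((N : ℝ) + γ)) := by
  have : Nonempty (Fin N) := ⟨⟨0, hN⟩⟩
  set c : ℝ := (2 * Real.pi * ‖ξ‖) ^ 2 with hc
  set F : ℝ → ℝ := fun r => if r ≤ 1 then c * r ^ (2 - ((N : ℝ) + γ)) else 4 * r ^ (-((N : ℝ) + γ))
    with hF
  have hpow : ∀ r : ℝ, 0 < r → r ^ (N - 1) = r ^ ((N : ℝ) - 1) := by
    intro r hr
    rw [← Real.rpow_natCast, Nat.cast_sub (by omega), Nat.cast_one]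
  have hFint : Integrable (fun y : EuclideanSpace ℝ (Fin N) => F ‖y‖) := by
    rw [integrable_fun_norm_addHaar, finrank_euclideanSpace_fin,
      ← Set.Ioc_union_Ioi_eq_Ioi zero_le_one]
    refine IntegrableOn.union ?_ ?_
    · have h1 : IntegrableOn (fun r : ℝ => c * r ^ (1 - γ)) (Set.Ioc 0 1) :=
        ((intervalIntegrable_iff_integrableOn_Ioc_of_le zero_le_one).1
          (intervalIntegral.intervalIntegrable_rpow' (by linarith))).const_mul c
      refine h1.congr_fun (fun r hr => ?_) measurableSet_Ioc
      simp only [hF, hr.2, if_true, smul_eq_mul]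
      rw [hpow r hr.1, mul_left_comm, ← Real.rpow_add hr.1]
      congr 2; ring
    · have h1 : IntegrableOn (fun r : ℝ => 4 * r ^ (-1 - γ)) (Set.Ioi 1) :=
        (integrableOn_Ioi_rpow_of_lt (by linarith) one_pos).const_mul 4
      refine h1.congr_fun (fun r hr => ?_) measurableSet_Ioi
      have hr1 : ¬ r ≤ 1 := not_le.2 hr
      have hr0 : 0 < r := one_pos.trans hr
      simp only [hF, hr1, if_false, smul_eq_mul]
      rw [hpow r hr0, mul_left_comm, ← Real.rpow_add hr0]
      congr 2; ring
  refine hFint.mono' (Measurable.aestronglyMeasurable (by fun_prop))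
    (Filter.Eventually.of_forall fun y => ?_)
  have hcos : 0 ≤ 2 - 2 * Real.cos (2 * Real.pi * ⟪ξ, y⟫) := by
    linarith [Real.cos_le_one (2 * Real.pi * ⟪ξ, y⟫)]
  rw [Real.norm_of_nonneg (by positivity)]
  rcases eq_or_ne y 0 with rfl | hy
  · simp only [inner_zero_right, mul_zero, Real.cos_zero, norm_zero, hF, zero_le_one, if_true]
    have : 0 ≤ c * (0 : ℝ) ^ (2 - ((N : ℝ) + γ)) := by positivity
    simpa using this
  have hy0 : 0 < ‖y‖ := norm_pos_iff.2 hy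
  by_cases h1 : ‖y‖ ≤ 1
  · simp only [hF, h1, if_true]
    rw [Real.rpow_sub hy0, Real.rpow_two, ← mul_div_assoc]
    gcongr
    have h2 := Real.one_sub_sq_div_two_le_cos (x := 2 * Real.pi * ⟪ξ, y⟫)
    have h3 : (2 * Real.pi * ⟪ξ, y⟫) ^ 2 ≤ c * ‖y‖ ^ 2 := by
      have h4 : (⟪ξ, y⟫) ^ 2 ≤ (‖ξ‖ * ‖y‖) ^ 2 := by
        rw [← sq_abs]
        gcongr
        exact abs_real_inner_le_norm ξ y
      calc _ = (2 * Real.pi) ^ 2 * (⟪ξ, y⟫) ^ 2 := by ring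
        _ ≤ (2 * Real.pi) ^ 2 * (‖ξ‖ * ‖y‖) ^ 2 := by gcongr
        _ = _ := by rw [hc]; ring
    linarith
  · simp only [hF, h1, if_false]
    rw [Real.rpow_neg hy0.le, ← div_eq_mul_inv]
    gcongr
    linarith [Real.neg_one_le_cos (2 * Real.pi * ⟪ξ, y⟫)]

theorem integral_fracKernel_smul {γ t : ℝ} (ht : 0 < t) (ξ : EuclideanSpace ℝ (Fin N)) :
    ∫ y : EuclideanSpace ℝ (Fin N),
      (2 - 2 * Real.cos (2 * Real.pi * ⟪t • ξ, y⟫)) / ‖y‖ ^ ((N : ℝ) + γ) =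
    t ^ γ * ∫ y : EuclideanSpace ℝ (Fin N),
      (2 - 2 * Real.cos (2 * Real.pi * ⟪ξ, y⟫)) / ‖y‖ ^ ((N : ℝ) + γ) := by
  have h := Measure.integral_comp_smul (volume : Measure (EuclideanSpace ℝ (Fin N)))
    (fun y => (2 - 2 * Real.cos (2 * Real.pi * ⟪ξ, y⟫)) / ‖y‖ ^ ((N : ℝ) + γ)) t
  rw [finrank_euclideanSpace_fin, abs_of_pos (by positivity), smul_eq_mul] at h
  have h2 : ∀ y : EuclideanSpace ℝ (Fin N),
      (2 - 2 * Real.cos (2 * Real.pi * ⟪t • ξ, y⟫)) / ‖y‖ ^ ((N : ℝ) + γ) =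
      t ^ ((N : ℝ) + γ) *
        ((2 - 2 * Real.cos (2 * Real.pi * ⟪ξ, t • y⟫)) / ‖t • y‖ ^ ((N : ℝ) + γ)) := by
    intro y
    rw [norm_smul, Real.norm_of_nonneg ht.le, Real.mul_rpow ht.le (norm_nonneg _),
      inner_smul_left, inner_smul_right, RCLike.conj_to_real, ← mul_div_assoc,
      mul_div_mul_left _ _ (by positivity)]
  simp_rw [h2]
  rw [integral_const_mul, h, ← mul_assoc, Real.rpow_add ht, Real.rpow_natCast]
  field_simp

/-- Vectors of equal length are exchanged by the reflection in the hyperplane orthogonal to `ξ - η`,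
which preserves the measure and the norm. -/
theorem integral_fracKernel_congr {γ : ℝ} {ξ η : EuclideanSpace ℝ (Fin N)} (h : ‖ξ‖ = ‖η‖) :
    ∫ y : EuclideanSpace ℝ (Fin N),
      (2 - 2 * Real.cos (2 * Real.pi * ⟪ξ, y⟫)) / ‖y‖ ^ ((N : ℝ) + γ) =
    ∫ y : EuclideanSpace ℝ (Fin N),
      (2 - 2 * Real.cos (2 * Real.pi * ⟪η, y⟫)) / ‖y‖ ^ ((N : ℝ) + γ) := by
  set R := Submodule.reflection (ℝ ∙ (ξ - η))ᗮ with hR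
  have h1 : R ξ = η := Submodule.reflection_sub h
  rw [← R.measurePreserving.integral_comp R.toHomeomorph.measurableEmbedding
    (fun y => (2 - 2 * Real.cos (2 * Real.pi * ⟪η, y⟫)) / ‖y‖ ^ ((N : ℝ) + γ))]
  congr 1
  ext y
  rw [← h1, LinearIsometryEquiv.inner_map_map, LinearIsometryEquiv.norm_map]

/-- Rotation invariance and homogeneity of degree `γ` determine the integral up to its value `k` at
a unit vector. -/
theorem exists_integral_fracKernel (hN : 0 < N) {γ : ℝ} (hγ : 0 < γ) (hγ2 : γ < 2) :
    ∃ k : ℝ, 0 < k ∧ ∀ ξ : EuclideanSpace ℝ (Fin N), ∫ y : EuclideanSpace ℝ (Fin N),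
      (2 - 2 * Real.cos (2 * Real.pi * ⟪ξ, y⟫)) / ‖y‖ ^ ((N : ℝ) + γ) = k * ‖ξ‖ ^ γ := by
  set e : EuclideanSpace ℝ (Fin N) := EuclideanSpace.single ⟨0, hN⟩ 1 with he
  have hnorm : ‖e‖ = 1 := by simp [he]
  refine ⟨∫ y : EuclideanSpace ℝ (Fin N),
      (2 - 2 * Real.cos (2 * Real.pi * ⟪e, y⟫)) / ‖y‖ ^ ((N : ℝ) + γ), ?_, fun ξ => ?_⟩
  · rw [integral_pos_iff_support_of_nonneg _ (integrable_fracKernel hN hγ hγ2 e)]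
    · have hopen : IsOpen {y : EuclideanSpace ℝ (Fin N) |
          2 - 2 * Real.cos (2 * Real.pi * ⟪e, y⟫) ≠ 0} :=
        isOpen_ne_fun (by fun_prop) continuous_const
      -- At `e / 2` the cosine is cos π = -1, so the integrand's support contains a nonempty open
      -- set.
      refine (hopen.measure_pos volume ⟨(1 / 2 : ℝ) • e, ?_⟩).trans_le (measure_mono fun y hy => ?_)
      · simp only [Set.mem_ofPred_eq, inner_smul_right, real_inner_self_eq_norm_sq, hnorm]
        rw [show 2 * Real.pi * (1 / 2 * 1 ^ 2) = Real.pi by ring, Real.cos_pi]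
        norm_num
      · have hy' : 2 - 2 * Real.cos (2 * Real.pi * ⟪e, y⟫) ≠ 0 := hy
        have hy0 : y ≠ 0 := by
          rintro rfl
          simp at hy'
        exact div_ne_zero hy' (Real.rpow_pos_of_pos (norm_pos_iff.2 hy0) _).ne'
    · intro y
      have := Real.cos_le_one (2 * Real.pi * ⟪e, y⟫)
      have h2 : 0 ≤ 2 - 2 * Real.cos (2 * Real.pi * ⟪e, y⟫) := by linarith
      simp only [Pi.zero_apply]
      positivity
  · rcases eq_or_ne ξ 0 with rfl | hξ
    · simp [Real.zero_rpow hγ.ne']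
    · rw [integral_fracKernel_congr (η := ‖ξ‖ • e) (by simp [norm_smul, hnorm]),
        integral_fracKernel_smul (norm_pos_iff.2 hξ), mul_comm]

end Kernel

/-! ### The Fourier symbol of the fractional Laplacian -/

section PlaneWave

variable {N : ℕ}

/-- The character `x ↦ exp(2πi⟨ξ, x⟩)`. -/
noncomputable def planeWave (ξ x : EuclideanSpace ℝ (Fin N)) : ℂ :=
  Complex.exp ((2 * Real.pi * ⟪ξ, x⟫ : ℝ) * Complex.I)

theorem norm_planeWave (ξ x : EuclideanSpace ℝ (Fin N)) : ‖planeWave ξ x‖ = 1 :=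
  Complex.norm_exp_ofReal_mul_I _

@[fun_prop]
theorem measurable_planeWave {α : Type*} [MeasurableSpace α] {f g : α → EuclideanSpace ℝ (Fin N)}
    (hf : Measurable f) (hg : Measurable g) : Measurable (fun a => planeWave (f a) (g a)) := by
  unfold planeWave
  fun_prop

theorem planeWave_add (ξ x y : EuclideanSpace ℝ (Fin N)) :
    planeWave ξ (x + y) = planeWave ξ x * planeWave ξ y := by
  rw [planeWave, planeWave, planeWave, ← Complex.exp_add, inner_add_right]
  push_cast
  congr 1; ring

theorem planeWave_second_difference (ξ x y : EuclideanSpace ℝ (Fin N)) :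
    2 * planeWave ξ x - planeWave ξ (x + y) - planeWave ξ (x - y) =
      planeWave ξ x * ((2 - 2 * Real.cos (2 * Real.pi * ⟪ξ, y⟫) : ℝ) : ℂ) := by
  rw [sub_eq_add_neg x y, planeWave_add, planeWave_add]
  have h : planeWave ξ y + planeWave ξ (-y) = (2 * Real.cos (2 * Real.pi * ⟪ξ, y⟫) : ℝ) := by
    rw [planeWave, planeWave, inner_neg_right]
    push_cast
    rw [Complex.two_cos]
    congr 2; ring
  push_cast at h ⊢
  linear_combination (-planeWave ξ x) * h

/-- The Fourier transform of a real Schwartz function. -/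
noncomputable def realFourier (u : 𝓢(EuclideanSpace ℝ (Fin N), ℝ)) :
    𝓢(EuclideanSpace ℝ (Fin N), ℂ) :=
  𝓕 (u.postcompCLM Complex.ofRealCLM)

theorem ofReal_eq_integral_planeWave (u : 𝓢(EuclideanSpace ℝ (Fin N), ℝ))
    (x : EuclideanSpace ℝ (Fin N)) :
    (u x : ℂ) = ∫ ξ, planeWave ξ x * realFourier u ξ := by
  have h : 𝓕⁻ (realFourier u) = u.postcompCLM Complex.ofRealCLM :=
    FourierTransform.fourierInv_fourier_eq _
  have h2 : (u x : ℂ) = 𝓕⁻ (realFourier u) x := by rw [h]; rfl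
  rw [h2, SchwartzMap.fourierInv_coe, Real.fourierInv_eq']
  rfl

theorem integrable_realFourier (u : 𝓢(EuclideanSpace ℝ (Fin N), ℝ)) :
    Integrable (realFourier u) := (realFourier u).integrable

/-- For exponents in [0, 1] the multiplier is at most 1 + |ξ|, and Schwartz decay absorbs this. -/
theorem integrable_rpow_mul_realFourier {γ : ℝ} (hγ : 0 ≤ γ) (hγ1 : γ ≤ 1)
    (u : 𝓢(EuclideanSpace ℝ (Fin N), ℝ)) :
    Integrable (fun ξ => ((‖ξ‖ ^ γ : ℝ) : ℂ) * realFourier u ξ) := by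
  have h1 := (realFourier u).integrable_pow_mul volume 1
  have h0 := (integrable_realFourier u).norm
  refine (h0.add h1).mono' ?_ (Filter.Eventually.of_forall fun ξ => ?_)
  · exact (Measurable.aestronglyMeasurable (by fun_prop)).mul
      (realFourier u).continuous.aestronglyMeasurable
  · rw [norm_mul, Complex.norm_real, Real.norm_of_nonneg (by positivity)]
    simp only [Pi.add_apply, pow_one]
    rw [← one_add_mul]
    gcongr
    rcases le_total ‖ξ‖ 1 with h | h
    · exact (Real.rpow_le_one (norm_nonneg _) h hγ).trans (by simp)
    · calc ‖ξ‖ ^ γ ≤ ‖ξ‖ ^ (1 : ℝ) := Real.rpow_le_rpow_of_exponent_le h hγ1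
        _ ≤ _ := by simp

theorem integrable_planeWave_mul {h : EuclideanSpace ℝ (Fin N) → ℂ} (hh : Integrable h)
    (x : EuclideanSpace ℝ (Fin N)) : Integrable fun ξ => planeWave ξ x * h ξ := by
  refine hh.bdd_mul (c := 1) (Measurable.aestronglyMeasurable (by fun_prop))
    (Filter.Eventually.of_forall fun ξ => (norm_planeWave ξ x).le)

theorem second_difference_eq_integral (u : 𝓢(EuclideanSpace ℝ (Fin N), ℝ))
    (x y : EuclideanSpace ℝ (Fin N)) :
    ((2 * u x - u (x + y) - u (x - y) : ℝ) : ℂ) = ∫ ξ, planeWave ξ x * realFourier u ξ *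
      ((2 - 2 * Real.cos (2 * Real.pi * ⟪ξ, y⟫) : ℝ) : ℂ) := by
  push_cast
  rw [ofReal_eq_integral_planeWave, ofReal_eq_integral_planeWave, ofReal_eq_integral_planeWave,
    ← integral_const_mul]
  have hi := fun z => integrable_planeWave_mul (integrable_realFourier u) z
  have h12 : Integrable fun ξ => 2 * (planeWave ξ x * realFourier u ξ) -
      planeWave ξ (x + y) * realFourier u ξ := ((hi x).const_mul 2).sub (hi (x + y))
  rw [← integral_sub ((hi x).const_mul 2) (hi _), ← integral_sub h12 (hi _)]
  congr 1
  ext ξ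
  have := planeWave_second_difference ξ x y
  push_cast at this ⊢
  linear_combination (realFourier u ξ) * this

/-- The singular-integral fractional Laplacian has Fourier symbol a multiple of `|ξ|^γ`. -/
theorem exists_fracLaplacian_eq_integral (hN : 0 < N) {γ : ℝ} (hγ : 0 < γ) (hγ1 : γ < 1) :
    ∃ c : ℝ, 0 < c ∧ ∀ (u : 𝓢(EuclideanSpace ℝ (Fin N), ℝ)) (x : EuclideanSpace ℝ (Fin N)),
      (fracLaplacian (γ / 2) u x : ℂ) =
        c * ∫ ξ, planeWave ξ x * (((‖ξ‖ ^ γ : ℝ) : ℂ) * realFourier u ξ) := by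
  obtain ⟨k, hk, hker⟩ := exists_integral_fracKernel hN hγ (by linarith)
  have hA : 0 < fracLaplacianConst N (γ / 2) := by
    unfold fracLaplacianConst
    have h1 := Real.Gamma_pos_of_pos (s := ((N : ℝ) + 2 * (γ / 2)) / 2) (by positivity)
    have h2 := Real.Gamma_pos_of_pos (s := 1 - γ / 2) (by linarith)
    positivity
  refine ⟨fracLaplacianConst N (γ / 2) / 2 * k, by positivity, fun u x => ?_⟩
  -- Fubini is checked with the `y`-integral inside: the kernel is nonnegative, so its absolute
  -- integral is again `k * ‖ξ‖ ^ γ`. Using second differences is what makes this converge.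
  have hint : Integrable (fun z : EuclideanSpace ℝ (Fin N) × EuclideanSpace ℝ (Fin N) =>
      planeWave z.2 x * realFourier u z.2 *
        (((2 - 2 * Real.cos (2 * Real.pi * ⟪z.2, z.1⟫)) / ‖z.1‖ ^ ((N : ℝ) + γ) : ℝ) : ℂ))
      (volume.prod volume) := by
    have hcont := (realFourier u).continuous.measurable
    have hnn : ∀ y ξ : EuclideanSpace ℝ (Fin N),
        0 ≤ (2 - 2 * Real.cos (2 * Real.pi * ⟪ξ, y⟫)) / ‖y‖ ^ ((N : ℝ) + γ) := by
      intro y ξ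
      have := Real.cos_le_one (2 * Real.pi * ⟪ξ, y⟫)
      have h2 : 0 ≤ 2 - 2 * Real.cos (2 * Real.pi * ⟪ξ, y⟫) := by linarith
      positivity
    have hmeas : AEStronglyMeasurable (fun z : EuclideanSpace ℝ (Fin N) × EuclideanSpace ℝ (Fin N) =>
        planeWave z.2 x * realFourier u z.2 *
        (((2 - 2 * Real.cos (2 * Real.pi * ⟪z.2, z.1⟫)) / ‖z.1‖ ^ ((N : ℝ) + γ) : ℝ) : ℂ))
        (volume.prod volume) := by
      have h1 : Measurable fun z : EuclideanSpace ℝ (Fin N) × EuclideanSpace ℝ (Fin N) =>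
          planeWave z.2 x * realFourier u z.2 :=
        (measurable_planeWave measurable_snd measurable_const).mul (hcont.comp measurable_snd)
      have h2 : Measurable fun z : EuclideanSpace ℝ (Fin N) × EuclideanSpace ℝ (Fin N) =>
          (2 - 2 * Real.cos (2 * Real.pi * ⟪z.2, z.1⟫)) / ‖z.1‖ ^ ((N : ℝ) + γ) := by
        fun_prop
      exact (h1.mul (Complex.measurable_ofReal.comp h2)).aestronglyMeasurable
    rw [integrable_prod_iff' hmeas]
    refine ⟨Filter.Eventually.of_forall fun ξ => ?_, ?_⟩
    · have h0 : Integrable (fun y : EuclideanSpace ℝ (Fin N) =>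
          (((2 - 2 * Real.cos (2 * Real.pi * ⟪ξ, y⟫)) / ‖y‖ ^ ((N : ℝ) + γ) : ℝ) : ℂ)) :=
        (integrable_fracKernel hN hγ (by linarith) ξ).ofReal
      exact h0.const_mul (planeWave ξ x * realFourier u ξ)
    have h1 := ((integrable_rpow_mul_realFourier hγ.le hγ1.le u).norm).const_mul k
    refine h1.congr (Filter.Eventually.of_forall fun ξ => ?_)
    simp only [norm_mul, norm_planeWave, Complex.norm_real, one_mul]
    rw [integral_const_mul]
    simp_rw [Real.norm_of_nonneg (hnn _ ξ)]
    rw [hker, Real.norm_of_nonneg (by positivity)]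
    ring
  rw [fracLaplacian, Complex.ofReal_mul, ← integral_complex_ofReal]
  have h1 : ∀ y : EuclideanSpace ℝ (Fin N),
      (((2 * u x - u (x + y) - u (x - y)) / ‖y‖ ^ ((N : ℝ) + 2 * (γ / 2)) : ℝ) : ℂ) =
      ∫ ξ, planeWave ξ x * realFourier u ξ *
        (((2 - 2 * Real.cos (2 * Real.pi * ⟪ξ, y⟫)) / ‖y‖ ^ ((N : ℝ) + γ) : ℝ) : ℂ) := by
    intro y
    rw [Complex.ofReal_div, second_difference_eq_integral, mul_div_cancel₀ γ two_ne_zero,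
      ← integral_div]
    congr 1
    ext ξ
    push_cast
    ring
  simp_rw [h1]
  rw [integral_integral_swap hint]
  have h2 : ∀ ξ : EuclideanSpace ℝ (Fin N), ∫ y, planeWave ξ x * realFourier u ξ *
        (((2 - 2 * Real.cos (2 * Real.pi * ⟪ξ, y⟫)) / ‖y‖ ^ ((N : ℝ) + γ) : ℝ) : ℂ) =
      k * (planeWave ξ x * (((‖ξ‖ ^ γ : ℝ) : ℂ) * realFourier u ξ)) := by
    intro ξ
    rw [integral_const_mul, integral_complex_ofReal, hker]
    push_cast
    ring
  simp_rw [h2]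
  rw [integral_const_mul]
  push_cast
  ring

end PlaneWave

/-! ### Inverting the symbol with Gaussians -/

section Inversion

variable {N : ℕ}

/-- Plane waves are eigenfunctions of convolution; the eigenvalue is the Fourier transform of the
Gaussian at `ξ`. -/
theorem integral_gaussian_mul_planeWave {b : ℝ} (hb : 0 < b) (ξ x : EuclideanSpace ℝ (Fin N)) :
    ∫ y, ((Real.exp (-b * ‖x - y‖ ^ 2) : ℝ) : ℂ) * planeWave ξ y =
      (((Real.pi / b) ^ ((N : ℝ) / 2) * Real.exp (-Real.pi ^ 2 * ‖ξ‖ ^ 2 / b) : ℝ) : ℂ) *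
        planeWave ξ x := by
  have h := fourier_gaussian_innerProductSpace (V := EuclideanSpace ℝ (Fin N)) (b := (b : ℂ))
    (by simpa using hb) ξ
  rw [Real.fourier_eq', finrank_euclideanSpace_fin] at h
  rw [← integral_sub_left_eq_self _ volume x]
  simp only [sub_sub_cancel]
  have h1 : ∀ y : EuclideanSpace ℝ (Fin N),
      ((Real.exp (-b * ‖y‖ ^ 2) : ℝ) : ℂ) * planeWave ξ (x - y) = planeWave ξ x *
        (Complex.exp ((-2 * Real.pi * ⟪y, ξ⟫ : ℝ) * Complex.I) •
          Complex.exp (-b * ‖y‖ ^ 2)) := by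
    intro y
    have h2 : planeWave ξ (-y) = Complex.exp ((-2 * Real.pi * ⟪y, ξ⟫ : ℝ) * Complex.I) := by
      rw [planeWave, inner_neg_right, real_inner_comm]
      congr 3
      ring
    rw [sub_eq_add_neg, planeWave_add, h2, smul_eq_mul]
    push_cast
    ring
  simp_rw [h1]
  rw [integral_const_mul, h, mul_comm]
  push_cast
  rw [Complex.ofReal_cpow (by positivity)]
  push_cast
  ring_nf

theorem integrable_gaussian_sub {b : ℝ} (hb : 0 < b) (x : EuclideanSpace ℝ (Fin N)) :
    Integrable fun y : EuclideanSpace ℝ (Fin N) => ((Real.exp (-b * ‖x - y‖ ^ 2) : ℝ) : ℂ) := by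
  have h := GaussianFourier.integrable_cexp_neg_mul_sq_norm_add
    (V := EuclideanSpace ℝ (Fin N)) (b := (b : ℂ)) (by simpa using hb) 0 0
  have h2 := h.comp_sub_left x
  refine h2.congr (Filter.Eventually.of_forall fun y => ?_)
  simp

theorem integral_gaussian_mul_integral_planeWave {b : ℝ} (hb : 0 < b)
    {h : EuclideanSpace ℝ (Fin N) → ℂ} (hh : Integrable h) (hm : Measurable h)
    (x : EuclideanSpace ℝ (Fin N)) :
    ∫ y, ((Real.exp (-b * ‖x - y‖ ^ 2) : ℝ) : ℂ) * ∫ ξ, planeWave ξ y * h ξ =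
      ∫ ξ, (((Real.pi / b) ^ ((N : ℝ) / 2) * Real.exp (-Real.pi ^ 2 * ‖ξ‖ ^ 2 / b) : ℝ) : ℂ) *
        (planeWave ξ x * h ξ) := by
  have hint : Integrable (fun z : EuclideanSpace ℝ (Fin N) × EuclideanSpace ℝ (Fin N) =>
      ((Real.exp (-b * ‖x - z.1‖ ^ 2) : ℝ) : ℂ) * (planeWave z.2 z.1 * h z.2))
      (volume.prod volume) := by
    refine ((integrable_gaussian_sub hb x).mul_prod hh).mono ?_
      (Filter.Eventually.of_forall fun z => ?_)
    · have h1 : Measurable fun z : EuclideanSpace ℝ (Fin N) × EuclideanSpace ℝ (Fin N) =>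
          planeWave z.2 z.1 * h z.2 :=
        (measurable_planeWave measurable_snd measurable_fst).mul (hm.comp measurable_snd)
      have h2 : Measurable fun z : EuclideanSpace ℝ (Fin N) × EuclideanSpace ℝ (Fin N) =>
          Real.exp (-b * ‖x - z.1‖ ^ 2) := by fun_prop
      exact ((Complex.measurable_ofReal.comp h2).mul h1).aestronglyMeasurable
    · simp only [norm_mul, norm_planeWave, one_mul, le_refl]
  simp_rw [← integral_const_mul]
  rw [integral_integral_swap hint]
  congr 1
  ext ξ
  simp_rw [← mul_assoc]
  rw [integral_mul_const, integral_gaussian_mul_planeWave hb]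

/-- The substitution b ↦ 1/b turns this into a Gamma integral. -/
theorem integral_rpow_mul_exp_neg_div {α r : ℝ} (hα : 0 < α) (hr : 0 < r) :
    ∫ b in Set.Ioi (0 : ℝ), b ^ (-α - 1) * Real.exp (-(r / b)) =
      (1 / r) ^ α * Real.Gamma α := by
  rw [← Real.integral_rpow_mul_exp_neg_mul_Ioi hα hr,
    ← integral_comp_rpow_Ioi (fun t => t ^ (α - 1) * Real.exp (-(r * t))) (p := -1) (by norm_num)]
  refine setIntegral_congr_fun measurableSet_Ioi fun b hb => ?_
  have hb0 : (0 : ℝ) < b := hb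
  simp only [abs_neg, abs_one, one_mul, smul_eq_mul]
  rw [← Real.rpow_mul hb0.le, ← mul_assoc, ← Real.rpow_add hb0, Real.rpow_neg_one]
  congr 2
  ring

/-- The weight is chosen so that the factor b^(-N/2) of the transformed Gaussian leaves b^(-γ/2-1),
which integrates to a multiple of |ξ|^(-γ). On the physical side the same weight produces
|x-y|^(γ-N). -/
theorem exists_integral_heatWeight {γ : ℝ} (hγ : 0 < γ) :
    ∃ k : ℝ, 0 < k ∧ ∀ ξ : EuclideanSpace ℝ (Fin N), ξ ≠ 0 →
      ∫ b in Set.Ioi (0 : ℝ), b ^ ((N - γ) / 2 - 1) *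
        ((Real.pi / b) ^ ((N : ℝ) / 2) * Real.exp (-Real.pi ^ 2 * ‖ξ‖ ^ 2 / b)) =
      k * ‖ξ‖ ^ (-γ) := by
  have hG := Real.Gamma_pos_of_pos (half_pos hγ)
  have hpi := Real.pi_pos
  refine ⟨Real.pi ^ ((N : ℝ) / 2) * Real.pi ^ (-γ) * Real.Gamma (γ / 2), by positivity,
    fun ξ hξ => ?_⟩
  have hξ0 : 0 < ‖ξ‖ := norm_pos_iff.2 hξ
  have h := integral_rpow_mul_exp_neg_div (half_pos hγ) (r := Real.pi ^ 2 * ‖ξ‖ ^ 2) (by positivity)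
  have h1 : (1 / (Real.pi ^ 2 * ‖ξ‖ ^ 2)) ^ (γ / 2) = Real.pi ^ (-γ) * ‖ξ‖ ^ (-γ) := by
    rw [← mul_pow, one_div, ← Real.rpow_natCast, ← Real.rpow_neg (by positivity),
      ← Real.rpow_mul (by positivity), ← Real.mul_rpow hpi.le hξ0.le]
    congr 1
    push_cast
    ring
  calc _ = ∫ b in Set.Ioi (0 : ℝ), Real.pi ^ ((N : ℝ) / 2) *
        (b ^ (-(γ / 2) - 1) * Real.exp (-(Real.pi ^ 2 * ‖ξ‖ ^ 2 / b))) := by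
        refine setIntegral_congr_fun measurableSet_Ioi fun b hb => ?_
        have hb0 : (0 : ℝ) < b := hb
        rw [Real.div_rpow hpi.le hb0.le, show -(γ / 2) - 1 = ((N - γ) / 2 - 1) - (N : ℝ) / 2 by ring,
          Real.rpow_sub hb0 ((N - γ) / 2 - 1) ((N : ℝ) / 2), neg_mul, neg_div]
        ring
    _ = _ := by
        rw [integral_const_mul, h, h1]
        ring

/-- Inversion of the multiplier `|ξ|^γ` by integrating against Gaussians. -/
theorem exists_integral_gaussian_eq (hN : 0 < N) {γ : ℝ} (hγ : 0 < γ) (hγ1 : γ ≤ 1) :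
    ∃ k : ℝ, 0 < k ∧ ∀ (u : 𝓢(EuclideanSpace ℝ (Fin N), ℝ)) (x : EuclideanSpace ℝ (Fin N)),
      ∫ b in Set.Ioi (0 : ℝ), ((b ^ ((N - γ) / 2 - 1) : ℝ) : ℂ) *
        ∫ y, ((Real.exp (-b * ‖x - y‖ ^ 2) : ℝ) : ℂ) *
          ∫ ξ, planeWave ξ y * (((‖ξ‖ ^ γ : ℝ) : ℂ) * realFourier u ξ) = k * (u x : ℂ) := by
  obtain ⟨k, hk, hw⟩ := exists_integral_heatWeight (N := N) hγ
  refine ⟨k, hk, fun u x => ?_⟩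
  have : Nonempty (Fin N) := ⟨⟨0, hN⟩⟩
  have hne : ∀ᵐ ξ : EuclideanSpace ℝ (Fin N), ξ ≠ 0 := by
    simp [ae_iff]
  set W : ℝ → EuclideanSpace ℝ (Fin N) → ℝ := fun b ξ => b ^ ((N - γ) / 2 - 1) *
    ((Real.pi / b) ^ ((N : ℝ) / 2) * Real.exp (-Real.pi ^ 2 * ‖ξ‖ ^ 2 / b)) with hW
  have hcont := (realFourier u).continuous.measurable
  have hWint : ∀ ξ : EuclideanSpace ℝ (Fin N), ξ ≠ 0 →
      Integrable (fun b => W b ξ) (volume.restrict (Set.Ioi 0)) := by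
    intro ξ hξ
    -- A non-integrable function has Bochner integral 0, whereas the value here is known to be
    -- positive.
    by_contra hcon
    have h1 := hw ξ hξ
    rw [integral_undef hcon] at h1
    have : 0 < k * ‖ξ‖ ^ (-γ) := mul_pos hk (Real.rpow_pos_of_pos (norm_pos_iff.2 hξ) _)
    linarith
  have hWnn : ∀ b ∈ Set.Ioi (0 : ℝ), ∀ ξ, 0 ≤ W b ξ := by
    intro b hb ξ
    have hb0 : (0 : ℝ) < b := hb
    have := Real.pi_pos
    simp only [hW]
    positivity
  have hm : Measurable fun ξ => ((‖ξ‖ ^ γ : ℝ) : ℂ) * realFourier u ξ := by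
    refine Measurable.mul ?_ hcont
    fun_prop
  have hWm : Measurable fun z : ℝ × EuclideanSpace ℝ (Fin N) => W z.1 z.2 := by
    simp only [hW]
    fun_prop
  have hmeas : AEStronglyMeasurable (fun z : ℝ × EuclideanSpace ℝ (Fin N) =>
      (planeWave z.2 x * (((‖z.2‖ ^ γ : ℝ) : ℂ) * realFourier u z.2)) * ((W z.1 z.2 : ℝ) : ℂ))
      ((volume.restrict (Set.Ioi 0)).prod volume) := by
    have h1 : Measurable fun z : ℝ × EuclideanSpace ℝ (Fin N) =>
        planeWave z.2 x * (((‖z.2‖ ^ γ : ℝ) : ℂ) * realFourier u z.2) :=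
      (measurable_planeWave measurable_snd measurable_const).mul (hm.comp measurable_snd)
    exact (h1.mul (Complex.measurable_ofReal.comp hWm)).aestronglyMeasurable
  have hcancel : ∀ ξ : EuclideanSpace ℝ (Fin N), ξ ≠ 0 → ‖ξ‖ ^ γ * ‖ξ‖ ^ (-γ) = 1 := by
    intro ξ hξ
    rw [← Real.rpow_add (norm_pos_iff.2 hξ)]
    simp
  have hint : Integrable (fun z : ℝ × EuclideanSpace ℝ (Fin N) =>
      (planeWave z.2 x * (((‖z.2‖ ^ γ : ℝ) : ℂ) * realFourier u z.2)) * ((W z.1 z.2 : ℝ) : ℂ))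
      ((volume.restrict (Set.Ioi 0)).prod volume) := by
    rw [integrable_prod_iff' hmeas]
    refine ⟨hne.mono fun ξ hξ => ?_, ?_⟩
    · have h0 : Integrable (fun b => ((W b ξ : ℝ) : ℂ)) (volume.restrict (Set.Ioi 0)) :=
        (hWint ξ hξ).ofReal
      exact h0.const_mul (planeWave ξ x * (((‖ξ‖ ^ γ : ℝ) : ℂ) * realFourier u ξ))
    · refine ((integrable_realFourier u).norm.const_mul k).congr (hne.mono fun ξ hξ => ?_)
      simp only [norm_mul, norm_planeWave, Complex.norm_real, one_mul]
      rw [integral_const_mul, setIntegral_congr_fun measurableSet_Ioi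
        (fun b hb => Real.norm_of_nonneg (hWnn b hb ξ)), hw ξ hξ, Real.norm_of_nonneg (by positivity)]
      linear_combination (-(k * ‖realFourier u ξ‖)) * hcancel ξ hξ
  calc _ = ∫ b in Set.Ioi (0 : ℝ), ∫ ξ,
        (planeWave ξ x * (((‖ξ‖ ^ γ : ℝ) : ℂ) * realFourier u ξ)) * ((W b ξ : ℝ) : ℂ) := by
        refine setIntegral_congr_fun measurableSet_Ioi fun b hb => ?_
        rw [integral_gaussian_mul_integral_planeWave hb
          (integrable_rpow_mul_realFourier hγ.le hγ1 u) hm, ← integral_const_mul]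
        congr 1
        ext ξ
        simp only [hW]
        push_cast
        ring
    _ = ∫ ξ, ∫ b in Set.Ioi (0 : ℝ),
        (planeWave ξ x * (((‖ξ‖ ^ γ : ℝ) : ℂ) * realFourier u ξ)) * ((W b ξ : ℝ) : ℂ) :=
        integral_integral_swap hint
    _ = ∫ ξ, k * (planeWave ξ x * realFourier u ξ) := by
        refine integral_congr_ae (hne.mono fun ξ hξ => ?_)
        dsimp only
        rw [integral_const_mul, integral_complex_ofReal, hw ξ hξ]
        have h1 : (((‖ξ‖ ^ γ : ℝ) : ℂ)) * ((‖ξ‖ ^ (-γ) : ℝ) : ℂ) = 1 := by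
          rw [← Complex.ofReal_mul, hcancel ξ hξ, Complex.ofReal_one]
        push_cast at h1 ⊢
        linear_combination (k * planeWave ξ x * realFourier u ξ) * h1
    _ = _ := by rw [integral_const_mul, ← ofReal_eq_integral_planeWave]

theorem measurable_fracLaplacian (s : ℝ) (u : 𝓢(EuclideanSpace ℝ (Fin N), ℝ)) :
    Measurable (fracLaplacian s u) := by
  have hu := u.continuous.measurable
  have h : StronglyMeasurable fun z : EuclideanSpace ℝ (Fin N) × EuclideanSpace ℝ (Fin N) =>
      (2 * u z.1 - u (z.1 + z.2) - u (z.1 - z.2)) / ‖z.2‖ ^ ((N : ℝ) + 2 * s) := by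
    refine Measurable.stronglyMeasurable ?_
    fun_prop
  exact (h.integral_prod_right'.measurable).const_mul _

/-- The Riesz kernel is a superposition of normalized indicators of balls. -/
theorem lintegral_rpow_mul_le_rieszJ (hN : 0 < N) {γ : ℝ} (hγN : γ < N)
    {g : EuclideanSpace ℝ (Fin N) → ℝ≥0∞} (hg : Measurable g) (x : EuclideanSpace ℝ (Fin N)) :
    ∫⁻ y, ENNReal.ofReal (‖x - y‖ ^ (γ - N)) * g y ≤ ENNReal.ofReal (N - γ) * rieszJ γ g x := by
  have : Nonempty (Fin N) := ⟨⟨0, hN⟩⟩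
  have hne : ∀ᵐ y : EuclideanSpace ℝ (Fin N), y ≠ x := by
    simp [ae_iff]
  have hc : (0 : ℝ) < N - γ := by linarith
  have hset : MeasurableSet {z : EuclideanSpace ℝ (Fin N) × ℝ | ‖x - z.1‖ < z.2} :=
    measurableSet_lt (by fun_prop) (by fun_prop)
  -- Write |x-y|^(γ-N) as (N-γ) times the integral of t^(γ-N-1) over t > |x-y|, then exchange the
  -- integrals.
  calc ∫⁻ y, ENNReal.ofReal (‖x - y‖ ^ (γ - N)) * g y
      = ∫⁻ y, ENNReal.ofReal (N - γ) * ∫⁻ t in Set.Ioi (0 : ℝ),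
          {z : EuclideanSpace ℝ (Fin N) × ℝ | ‖x - z.1‖ < z.2}.indicator
            (fun z => ENNReal.ofReal (z.2 ^ (γ - N - 1)) * g z.1) (y, t) := by
        refine lintegral_congr_ae (hne.mono fun y hy => ?_)
        have hpos : 0 < ‖x - y‖ := norm_pos_iff.2 (sub_ne_zero.2 hy.symm)
        have h1 : ∫⁻ t in Set.Ioi (0 : ℝ),
            {z : EuclideanSpace ℝ (Fin N) × ℝ | ‖x - z.1‖ < z.2}.indicator
              (fun z => ENNReal.ofReal (z.2 ^ (γ - N - 1)) * g z.1) (y, t) =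
            ∫⁻ t in Set.Ioi ‖x - y‖, ENNReal.ofReal (t ^ (γ - N - 1)) * g y := by
          rw [← lintegral_indicator measurableSet_Ioi, ← lintegral_indicator measurableSet_Ioi]
          refine lintegral_congr fun t => ?_
          by_cases ht : ‖x - y‖ < t
          · have ht0 : 0 < t := hpos.trans ht
            simp [Set.indicator_apply, ht, ht0]
          · simp [Set.indicator_apply, ht]
        dsimp only
        rw [h1, lintegral_mul_const _ (by fun_prop),
          lintegral_Ioi_rpow_sub_one (by linarith) hpos, ← mul_assoc, ← ENNReal.ofReal_mul hc.le]
        congr 2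
        rw [neg_sub]
        field_simp
    _ = ENNReal.ofReal (N - γ) * ∫⁻ t in Set.Ioi (0 : ℝ), ∫⁻ y,
          {z : EuclideanSpace ℝ (Fin N) × ℝ | ‖x - z.1‖ < z.2}.indicator
            (fun z => ENNReal.ofReal (z.2 ^ (γ - N - 1)) * g z.1) (y, t) := by
        rw [lintegral_const_mul' _ _ (by simp), lintegral_lintegral_swap]
        refine (Measurable.indicator ?_ hset).aemeasurable
        fun_prop
    _ ≤ _ := by
        refine mul_le_mul_right (setLIntegral_mono' measurableSet_Ioi fun t ht => le_of_eq ?_) _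
        have ht0 : (0 : ℝ) < t := ht
        rw [ballAvg, ← mul_assoc, ENNReal.ofReal_rpow_mul_cancel ht0,
          ← lintegral_const_mul _ hg, ← lintegral_indicator measurableSet_ball]
        refine lintegral_congr fun y => ?_
        rw [show γ - 1 + -(N : ℝ) = γ - N - 1 by ring]
        by_cases hy : ‖x - y‖ < t
        · have : y ∈ Metric.ball x t := by rwa [Metric.mem_ball', dist_eq_norm]
          simp [hy, this]
        · have : y ∉ Metric.ball x t := by rwa [Metric.mem_ball', dist_eq_norm]
          simp [hy, this]

theorem lintegral_Ioi_rpow_mul_exp {β r : ℝ} (hβ : 0 < β) (hr : 0 < r) :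
    ∫⁻ b in Set.Ioi (0 : ℝ), ENNReal.ofReal (b ^ (β - 1) * Real.exp (-b * r)) =
      ENNReal.ofReal ((1 / r) ^ β * Real.Gamma β) := by
  have h := Real.integral_rpow_mul_exp_neg_mul_Ioi hβ hr
  have hpos : 0 < (1 / r) ^ β * Real.Gamma β :=
    mul_pos (by positivity) (Real.Gamma_pos_of_pos hβ)
  have hint : IntegrableOn (fun b : ℝ => b ^ (β - 1) * Real.exp (-(r * b))) (Set.Ioi 0) := by
    by_contra hcon
    rw [integral_undef hcon] at h
    linarith
  rw [← h, ofReal_integral_eq_lintegral_ofReal hint]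
  · congr 1
    ext b
    congr 3
    ring
  · filter_upwards [ae_restrict_mem measurableSet_Ioi] with b hb
    have hb0 : (0 : ℝ) < b := hb
    positivity

/-- A Schwartz function is dominated by the Riesz potential of its fractional Laplacian. -/
theorem exists_enorm_le_rieszJ_fracLaplacian (hN : 0 < N) {γ : ℝ} (hγ : 0 < γ) (hγ1 : γ < 1) :
    ∃ C : ℝ≥0∞, C ≠ ⊤ ∧ ∀ (u : 𝓢(EuclideanSpace ℝ (Fin N), ℝ)) (x : EuclideanSpace ℝ (Fin N)),
      ‖u x‖ₑ ≤ C * rieszJ γ (fun y => ‖fracLaplacian (γ / 2) u y‖ₑ) x := by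
  have : Nonempty (Fin N) := ⟨⟨0, hN⟩⟩
  have hN1 : (1 : ℝ) ≤ N := by exact_mod_cast hN
  obtain ⟨c, hc, hfrac⟩ := exists_fracLaplacian_eq_integral hN hγ hγ1
  obtain ⟨k, hk, hinv⟩ := exists_integral_gaussian_eq hN hγ hγ1.le
  set β : ℝ := (N - γ) / 2 with hβ
  have hβ0 : 0 < β := by rw [hβ]; linarith
  have hck : ENNReal.ofReal (c * k) ≠ 0 := by
    simp only [ne_eq, ENNReal.ofReal_eq_zero, not_le]
    positivity
  refine ⟨(ENNReal.ofReal (c * k))⁻¹ * (ENNReal.ofReal (Real.Gamma β) * ENNReal.ofReal (N - γ)),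
    ENNReal.mul_ne_top (ENNReal.inv_ne_top.2 hck) (by finiteness), fun u x => ?_⟩
  set f := fracLaplacian (γ / 2) u with hf
  have hfm : Measurable f := measurable_fracLaplacian _ u
  -- Here `c` comes from the symbol and `k` from its Gaussian inversion.
  have hrep : ((c * k : ℝ) : ℂ) * (u x : ℂ) = ∫ b in Set.Ioi (0 : ℝ), ((b ^ (β - 1) : ℝ) : ℂ) *
      ∫ y, ((Real.exp (-b * ‖x - y‖ ^ 2) : ℝ) : ℂ) * (f y : ℂ) := by
    rw [Complex.ofReal_mul, mul_assoc, ← hinv u x, ← integral_const_mul]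
    congr 1
    ext b
    rw [mul_left_comm, ← integral_const_mul]
    congr 2
    ext y
    rw [hfrac u y]
    ring
  have henorm : ∀ t : ℝ, ‖(t : ℂ)‖ₑ = ‖t‖ₑ := fun t => by
    rw [← ofReal_norm, Complex.norm_real, ofReal_norm]
  -- All kernels are positive, so absolute values go inside and Tonelli applies. Integrating in `b`
  -- first gives Γ(β)|x-y|^(-2β), with 2β = N - γ.
  have hmain : ENNReal.ofReal (c * k) * ‖u x‖ₑ ≤
      ENNReal.ofReal (Real.Gamma β) * (ENNReal.ofReal (N - γ) * rieszJ γ (fun y => ‖f y‖ₑ) x) := by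
    calc ENNReal.ofReal (c * k) * ‖u x‖ₑ = ‖((c * k : ℝ) : ℂ) * (u x : ℂ)‖ₑ := by
          rw [enorm_mul, henorm, henorm, Real.enorm_of_nonneg (by positivity : 0 ≤ c * k)]
      _ ≤ ∫⁻ b in Set.Ioi (0 : ℝ), ∫⁻ y,
          ENNReal.ofReal (b ^ (β - 1) * Real.exp (-b * ‖x - y‖ ^ 2)) * ‖f y‖ₑ := by
          rw [hrep]
          refine (enorm_integral_le_lintegral_enorm _).trans
            (setLIntegral_mono' measurableSet_Ioi fun b hb => ?_)
          have hb0 : (0 : ℝ) < b := hb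
          rw [enorm_mul]
          refine (mul_le_mul_right (enorm_integral_le_lintegral_enorm _) _).trans (le_of_eq ?_)
          rw [← lintegral_const_mul' _ _ (by simp)]
          refine lintegral_congr fun y => ?_
          rw [enorm_mul, ← mul_assoc, ENNReal.ofReal_mul (by positivity), henorm, henorm, henorm,
            Real.enorm_of_nonneg (by positivity), Real.enorm_of_nonneg (by positivity)]
      _ = ∫⁻ y, (∫⁻ b in Set.Ioi (0 : ℝ),
          ENNReal.ofReal (b ^ (β - 1) * Real.exp (-b * ‖x - y‖ ^ 2))) * ‖f y‖ₑ := by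
          rw [lintegral_lintegral_swap (Measurable.aemeasurable (by fun_prop))]
          refine lintegral_congr fun y => ?_
          rw [lintegral_mul_const _ (by fun_prop)]
      _ = ∫⁻ y, ENNReal.ofReal (Real.Gamma β) *
          (ENNReal.ofReal (‖x - y‖ ^ (γ - N)) * ‖f y‖ₑ) := by
          have hne : ∀ᵐ y : EuclideanSpace ℝ (Fin N), y ≠ x := by simp [ae_iff]
          refine lintegral_congr_ae (hne.mono fun y hy => ?_)
          have hpos : 0 < ‖x - y‖ := norm_pos_iff.2 (sub_ne_zero.2 hy.symm)
          dsimp only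
          rw [lintegral_Ioi_rpow_mul_exp hβ0 (by positivity), mul_comm (_ ^ β),
            ENNReal.ofReal_mul (Real.Gamma_pos_of_pos hβ0).le, mul_assoc]
          congr 3
          rw [one_div, ← Real.rpow_natCast, ← Real.rpow_neg (by positivity),
            ← Real.rpow_mul (by positivity), hβ]
          congr 1
          push_cast
          ring
      _ ≤ _ := by
          rw [lintegral_const_mul' _ _ (by simp)]
          exact mul_le_mul_right (lintegral_rpow_mul_le_rieszJ hN (by linarith) hfm.enorm x) _
  calc ‖u x‖ₑ = (ENNReal.ofReal (c * k))⁻¹ * (ENNReal.ofReal (c * k) * ‖u x‖ₑ) := by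
        rw [← mul_assoc, ENNReal.inv_mul_cancel hck (by simp), one_mul]
    _ ≤ _ := by
        rw [mul_assoc, mul_assoc]
        exact mul_le_mul_right hmain _

end Inversion

/-! ### Fractional Sobolev inequality and conclusion -/

/-- The Sobolev inequality in Morrey spaces for the fractional Laplacian. -/
theorem exists_eMorrey_le_fracLaplacian {N : ℕ} (hN : 0 < N) {lam p γ s : ℝ} (hp : 1 < p)
    (hγ : 0 < γ) (hγ1 : γ < 1) (hlam : lam < N - γ * p)
    (hs : 1 / s = 1 / p - γ / (N - lam)) :
    ∃ C : ℝ≥0∞, C ≠ ⊤ ∧ ∀ u : 𝓢(EuclideanSpace ℝ (Fin N), ℝ),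
      eMorrey lam s (fun x => ‖u x‖ₑ) ≤
        C * eMorrey lam p (fun x => ‖fracLaplacian (γ / 2) u x‖ₑ) := by
  have hs0 : 0 < s := by
    rw [← one_div_pos, hs, sub_pos, div_lt_div_iff₀ (by nlinarith) (by linarith)]
    linarith
  obtain ⟨C, hC, hadams⟩ := exists_eMorrey_rieszJ_le hN hp hγ hlam hs
  obtain ⟨D, hD, hD'⟩ := exists_enorm_le_rieszJ_fracLaplacian hN hγ hγ1
  refine ⟨D * C, by finiteness, fun u => ?_⟩
  calc _ ≤ eMorrey lam s (fun x => D * rieszJ γ (fun y => ‖fracLaplacian (γ / 2) u y‖ₑ) x) :=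
        eMorrey_mono_ae hs0 (Filter.Eventually.of_forall (hD' u))
    _ ≤ D * eMorrey lam s (rieszJ γ (fun y => ‖fracLaplacian (γ / 2) u y‖ₑ)) :=
        eMorrey_const_mul_le hs0 _ hD
    _ ≤ D * (C * eMorrey lam p (fun x => ‖fracLaplacian (γ / 2) u x‖ₑ)) := by
        gcongr
        exact hadams _ (measurable_fracLaplacian _ u).enorm.aemeasurable
    _ = _ := by ring

/-- Interpolating a Sobolev inequality with a second Morrey norm. -/
theorem morreyNorm_le_of_eMorrey_le {N : ℕ} {F : Type*} [NormedAddCommGroup F]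
    {lam p q r s a : ℝ} (hq : 0 < q) (hs : 0 < s) (hr : 0 < r) (ha : a ∈ Set.Icc (0 : ℝ) 1)
    (h : 1 / q = a * (1 / s) + (1 - a) / r) {C : ℝ≥0∞} (hC : C ≠ ⊤)
    {u : EuclideanSpace ℝ (Fin N) → ℝ} (hu : AEStronglyMeasurable u volume)
    {G : EuclideanSpace ℝ (Fin N) → F}
    (hG : eMorrey lam s (fun x => ‖u x‖ₑ) ≤ C * eMorrey lam p (fun x => ‖G x‖ₑ)) :
    morreyNorm lam q u ≤ ENNReal.ofReal ((C ^ a).toReal + 1) * morreyNorm lam p G ^ a *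
      morreyNorm lam r u ^ (1 - a) := by
  simp only [morreyNorm_eq_eMorrey]
  -- Adding 1 keeps the real constant strictly positive even if `C ^ a` is 0.
  have hCa : C ^ a ≤ ENNReal.ofReal ((C ^ a).toReal + 1) := by
    rw [ENNReal.ofReal_add (by positivity) zero_le_one,
      ENNReal.ofReal_toReal (ENNReal.rpow_ne_top_of_nonneg ha.1 hC)]
    exact le_self_add
  calc _ ≤ eMorrey lam s (fun x => ‖u x‖ₑ) ^ a * eMorrey lam r (fun x => ‖u x‖ₑ) ^ (1 - a) :=
        eMorrey_interpolation hq hs hr ha (by rw [h]; ring) hu.enorm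
    _ ≤ (C * eMorrey lam p (fun x => ‖G x‖ₑ)) ^ a * eMorrey lam r (fun x => ‖u x‖ₑ) ^ (1 - a) := by
        gcongr
        exact ha.1
    _ ≤ _ := by
        rw [ENNReal.mul_rpow_of_nonneg _ _ ha.1]
        gcongr

theorem theorem5p15 (N : ℕ) (p lam a q r : ℝ) (hp : 1 < p) (hlam : 0 < lam)
    (ha : a ∈ Set.Icc (0 : ℝ) 1) (hq : 1 < q) (hr : 1 ≤ r) :
    (p < N → lam < N - p → 1 / q = a * (1 / p - 1 / (N - lam)) + (1 - a) / r →
      ∃ C : ℝ, 0 < C ∧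
        ∀ (u : EuclideanSpace ℝ (Fin N) → ℝ)
          (G : EuclideanSpace ℝ (Fin N) → EuclideanSpace ℝ (Fin N)),
          MemMorrey lam r u → HasWeakGradient u G →
            morreyNorm lam q u ≤
              ENNReal.ofReal C * morreyNorm lam p G ^ a * morreyNorm lam r u ^ (1 - a)) ∧
    (∀ γ ∈ Set.Ioo (0 : ℝ) 1, p < N / γ → lam < N - γ * p →
      1 / q = a * (1 / p - γ / (N - lam)) + (1 - a) / r →
      ∃ C : ℝ, 0 < C ∧
        ∀ u : 𝓢(EuclideanSpace ℝ (Fin N), ℝ),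
          morreyNorm lam q u ≤
            ENNReal.ofReal C * morreyNorm lam p (fracLaplacian (γ / 2) u) ^ a *
              morreyNorm lam r u ^ (1 - a)) := by
  have hp0 : 0 < p := by linarith
  refine ⟨fun hpN hl h => ?_, fun γ hγ _ hl h => ?_⟩
  · have hs : 1 / (1 / (1 / p - 1 / (N - lam))) = 1 / p - 1 / (N - lam) := one_div_one_div _
    have hs0 : 0 < 1 / (1 / p - 1 / (N - lam)) := by
      rw [one_div_pos, sub_pos, div_lt_div_iff₀ (by linarith) hp0]
      linarith
    obtain ⟨C, hC, hsob⟩ := exists_eMorrey_le_weakGradient hp hr hpN hl hs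
    exact ⟨(C ^ a).toReal + 1, by positivity, fun u G hu hG =>
      morreyNorm_le_of_eMorrey_le (by linarith) hs0 (by linarith) ha (by rw [hs, h]) hC hu.1
        (hsob u G hu.2.ne hG)⟩
  · have hs : 1 / (1 / (1 / p - γ / (N - lam))) = 1 / p - γ / (N - lam) := one_div_one_div _
    have hpγ : 0 < γ * p := mul_pos hγ.1 hp0
    have hN : 0 < N := by
      have : (0 : ℝ) < N := by linarith
      exact_mod_cast this
    have hs0 : 0 < 1 / (1 / p - γ / (N - lam)) := by
      rw [one_div_pos, sub_pos, div_lt_div_iff₀ (by linarith) hp0]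
      linarith
    obtain ⟨C, hC, hsob⟩ := exists_eMorrey_le_fracLaplacian hN hp hγ.1 hγ.2 hl hs
    exact ⟨(C ^ a).toReal + 1, by positivity, fun u =>
      morreyNorm_le_of_eMorrey_le (by linarith) hs0 (by linarith) ha (by rw [hs, h]) hC
        u.continuous.aestronglyMeasurable (hsob u)⟩
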